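/- **Conventions.** Fix $k\ge 2$. A $k$-graph is a finite $k$-uniform hypergraph $H=(V(H),E(H))$; $v(H)=|V(H)|$, $e(H)=|E(H)|$; $J\subseteq H$ means that $J$ is a (not necessarily induced) subhypergraph; a *copy* of $H$ is a $k$-graph isomorphic to $H$; unions of $k$-graphs are taken on vertices and edges and need not be disjoint. Put $d_k(H)=\frac{e(H)-1}{v(H)-k}$ if $e(H)\ge 1$ and $v(H)\ge k+1$, $d_k(H)=\frac1k$ if $H$ is a single edge on $k$ vertices, and $d_k(H)=0$ otherwise; $m_k(H)=\max_{J\subseteq H}d_k(J)$. For $k$-graphs $H_1,H_2$ put $d_k(H_1,H_2)=\frac{e(H_1)}{v(H_1)-k+1/m_k(H_2)}$ if $e(H_2)\ge 1$ and $v(H_1)\ge k$, and $0$ otherwise; $m_k(H_1,H_2)=\max_{J\subseteq H_1}d_k(J,H_2)$. $H$ is *strictly $k$-balanced* if $d_k(J)<m_k(H)$ for all $J\subsetneq H$; $H_1$ is *strictly balanced with respect to $d_k(\cdot,H_2)$* if $d_k(J,H_2)<m_k(H_1,H_2)$ for all $J\subsetneq H_1$. A pair $(H_1,H_2)$ with $m_k(H_1)\ge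 m_k(H_2)$ is a *heart* if $H_2$ is strictly $k$-balanced and, when $m_k(H_1)=m_k(H_2)$, $H_1$ is strictly $k$-balanced, while, when $m_k(H_1)>m_k(H_2)$, $H_1$ is strictly balanced with respect to $d_k(\cdot,H_2)$. For $\varepsilon\ge 0$ let $\lambda(F)=v(F)-\frac{e(F)}{m_k(H_1,H_2)}$ and $\gamma=\frac1{m_k(H_1,H_2)}-\frac1{m_k(H_1,H_2)+\varepsilon}$. Call $F$ *admissible* if $\lambda(\tilde F)>-\gamma$ for every $\tilde F\subseteq F$ with at least one vertex. **The procedure Grow-$\hat{\mathcal B}_\varepsilon$ (for $m_k(H_1)>m_k(H_2)$).** An edge $f$ of $F$ is *open in $F$* unless it lies in a copy $L\subseteq F$ of $H_2$ such that for every $e\in E(L)$ there is a copy $R\subseteq F$ of $H_1$ with $E(L)\cap E(R)=\{e\}$. A *fully open flower* of $F$ is a $k$-graph $J=L\cup\bigcup_{e'\in E(L)\setminus\{e\}}R_{e'}$ such that $F=G\cup J$ for some $k$-graph $G$ with $e\in E(G)$, where $L$ is a copy of $H_2$ with $E(L)\cap E(G)=\{e\}$ and $V(L)\cap V(G)=e$,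 each $R_{e'}$ is a copy of $H_1$ with $E(R_{e'})\cap(E(L)\cup E(G))=\{e'\}$ and $V(R_{e'})\cap(V(L)\cup V(G))=e'$, and $V(R_{e'})\cap V(R_{e''})=e'\cap e''$ for distinct $e',e''$. A function Eligible-Edge is fixed which assigns to each $F$ with an open edge an open edge of $F$, one that belongs to no fully open flower of $F$ whenever such an open edge exists, and which is unique up to isomorphism: if $F\cong F'$ then some isomorphism $F\to F'$ maps Eligible-Edge$(F)$ to Eligible-Edge$(F')$. Two operations produce a $k$-graph $F'$ from $F$: * *Attach-$H_1$*: choose $k$ distinct vertices of $F$ and a copy $R$ of $H_1$ containing them with $E(R)\not\subseteq E(F)$, and put $F'=F\cup R$. * *Close-$e$* (for $e\in E(F)$): choose a copy $L$ of $H_2$ containing the edge $e$ such that $|e'\cap V(F)|<k$ for all $e'\in E(L)\setminus E(F)$, and for each such $e'$ a copy $R_{e'}$ of $H_1$ with $E(L)\cap E(R_{e'})=\{e'\}$ and $|V(R_{e'})\cap V(F)|\le k-1$; put $F'=F\cup L\cup\bigcup_{e'}R_{e'}$. Start with $F_0=H_1$. As long as $F_i$ is admissible: if $F_i$ has an open edge,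 $F_{i+1}$ is obtained from $F_i$ either by Attach-$H_1$ or by Close-$e$ with $e=$ Eligible-Edge$(F_i)$; if $F_i$ has no open edge, $F_i$ is output, and the procedure continues with $F_{i+1}$ obtained either by Attach-$H_1$ or by Close-$e$ for any $e\in E(F_i)$, provided that at least one new edge is added. All possible choices are considered. **The procedure Grow-$\hat{\mathcal B}_\varepsilon$-Alt (for $m_k(H_1)=m_k(H_2)$).** An edge $f$ of $F$ is now *open in $F$* if there are no copies $L\subseteq F$ of $H_2$ and $R\subseteq F$ of $H_1$ with $E(L)\cap E(R)=\{f\}$. A *fully open flower* of $F$ is now a copy $J$ of $H_1$ or $H_2$ such that $F=G\cup J$ for some $k$-graph $G$ and some $e\in E(G)$ with $E(J)\cap E(G)=\{e\}$ and $V(J)\cap V(G)=e$. Eligible-Edge-Alt is a function with the same properties as above for these notions. *Close-$e$-Alt*: choose $L\cong H_2$ and $R\cong H_1$ with $E(L)\cap E(R)=\{e\}$ such that exactly one of $L,R$ is a subhypergraph of $F$, and let $F'$ be the union of $F$ with the other one. Start with $F_0=H_1$. As long as $F_i$ is admissible: if $F_i$ has an open edge, $F_{i+1}$ is obtained by Close-$e$-Alt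 with $e=$ Eligible-Edge-Alt$(F_i)$; otherwise $F_i$ is output and $F_{i+1}$ is obtained by Close-$e$-Alt for any $e\in E(F_i)$. Let $\hat{\mathcal B}(H_1,H_2,\varepsilon)$ be the set of all outputs of Grow-$\hat{\mathcal B}_\varepsilon$ if $m_k(H_1)>m_k(H_2)$, and of Grow-$\hat{\mathcal B}_\varepsilon$-Alt if $m_k(H_1)=m_k(H_2)$. **Theorem.** Let $k\ge 2$, and let $(H_1,H_2)$ be a heart of $k$-graphs with $m_k(H_1)\ge m_k(H_2)>1$. Then for every real $\varepsilon\ge 0$ (and every choice of Eligible-Edge and Eligible-Edge-Alt as above) the family $\hat{\mathcal B}(H_1,H_2,\varepsilon)$ is finite up to isomorphism. -/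

import Mathlib

/-- A finite `k`-uniform hypergraph ("`k`-graph") whose vertices are labelled by natural numbers.
Every finite `k`-graph is isomorphic to one of these. -/
@[ext] structure KGraph (k : ℕ) where
  V : Finset ℕ
  E : Finset (Finset ℕ)
  edge_subset : ∀ e ∈ E, e ⊆ V
  edge_card : ∀ e ∈ E, e.card = k

namespace KGraph

variable {k : ℕ}

/-- `J ≤ H` is the subhypergraph relation (not necessarily induced), `J < H` means that `J` is a
proper subhypergraph of `H`. -/
instance : PartialOrder (KGraph k) :=
  PartialOrder.lift (fun G => (G.V, G.E)) (fun _ _ h =>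
    KGraph.ext (congrArg Prod.fst h) (congrArg Prod.snd h))

theorem le_iff {J H : KGraph k} : J ≤ H ↔ J.V ⊆ H.V ∧ J.E ⊆ H.E := Iff.rfl

/-- The (not necessarily disjoint) union of two `k`-graphs. -/
instance : Union (KGraph k) where
  union F G :=
    { V := F.V ∪ G.V
      E := F.E ∪ G.E
      edge_subset := fun e he => by
        rcases Finset.mem_union.1 he with h | h
        · exact (F.edge_subset e h).trans Finset.subset_union_left
        · exact (G.edge_subset e h).trans Finset.subset_union_right
      edge_card := fun e he => by
        rcases Finset.mem_union.1 he with h | h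
        · exact F.edge_card e h
        · exact G.edge_card e h }

/-- The union of the `k`-graphs `R e'` over all `e'` in a finite set `S`. -/
def iUnionOver (S : Finset (Finset ℕ)) (R : Finset ℕ → KGraph k) : KGraph k where
  V := S.biUnion fun e' => (R e').V
  E := S.biUnion fun e' => (R e').E
  edge_subset := fun e he => by
    obtain ⟨s, hs, h⟩ := Finset.mem_biUnion.1 he
    exact ((R s).edge_subset e h).trans (Finset.subset_biUnion_of_mem (fun e' => (R e').V) hs)
  edge_card := fun e he => by
    obtain ⟨s, _, h⟩ := Finset.mem_biUnion.1 he
    exact (R s).edge_card e h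

/-- `φ` restricts to an isomorphism from `F` onto `F'`. -/
def IsIsoVia (φ : ℕ → ℕ) (F F' : KGraph k) : Prop :=
  Set.InjOn φ F.V ∧ F'.V = F.V.image φ ∧ F'.E = F.E.image fun e => e.image φ

/-- `F` and `F'` are isomorphic; `H.Iso R` is also read "`R` is a copy of `H`". -/
def Iso (F F' : KGraph k) : Prop := ∃ φ : ℕ → ℕ, IsIsoVia φ F F'

/-! ### Densities -/

open Classical in
/-- `d_k(H)`. The second case is that of a single edge without further vertices. -/
noncomputable def dens (H : KGraph k) : ℝ :=
  if H.E.Nonempty ∧ k + 1 ≤ H.V.card then ((H.E.card : ℝ) - 1) / ((H.V.card : ℝ) - k)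
  else if H.V.card = k ∧ H.E.card = 1 then 1 / (k : ℝ)
  else 0

/-- The `k`-density `m_k(H)`, the maximum of `d_k(J)` over all `J ⊆ H`. -/
noncomputable def mDens (H : KGraph k) : ℝ := sSup {d : ℝ | ∃ J : KGraph k, J ≤ H ∧ d = J.dens}

open Classical in
/-- `d_k(H₁, H₂)`. -/
noncomputable def dens₂ (H₁ H₂ : KGraph k) : ℝ :=
  if H₂.E.Nonempty ∧ k ≤ H₁.V.card then
    (H₁.E.card : ℝ) / ((H₁.V.card : ℝ) - k + 1 / H₂.mDens)
  else 0

/-- The asymmetric `k`-density `m_k(H₁, H₂)`, the maximum of `d_k(J, H₂)` over all `J ⊆ H₁`. -/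
noncomputable def mDens₂ (H₁ H₂ : KGraph k) : ℝ :=
  sSup {d : ℝ | ∃ J : KGraph k, J ≤ H₁ ∧ d = J.dens₂ H₂}

theorem finite_subgraphs (H : KGraph k) : {J : KGraph k | J ≤ H}.Finite := by
  refine Set.Finite.of_finite_image (f := fun G => (G.V, G.E))
    ((H.V.powerset ×ˢ H.E.powerset).finite_toSet.subset ?_) ?_
  · rintro _ ⟨J, hJ, rfl⟩
    simpa using le_iff.1 hJ
  · intro F _ G _ h
    exact KGraph.ext (congrArg Prod.fst h) (congrArg Prod.snd h)

/-- The supremum over all subhypergraphs of a real-valued parameter is a maximum. -/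
theorem isGreatest_sSup_subgraphs (H : KGraph k) (f : KGraph k → ℝ) :
    IsGreatest {d : ℝ | ∃ J : KGraph k, J ≤ H ∧ d = f J}
      (sSup {d : ℝ | ∃ J : KGraph k, J ≤ H ∧ d = f J}) := by
  have hfin : {d : ℝ | ∃ J : KGraph k, J ≤ H ∧ d = f J}.Finite :=
    (H.finite_subgraphs.image f).subset (by rintro d ⟨J, hJ, rfl⟩; exact ⟨J, hJ, rfl⟩)
  have hne : {d : ℝ | ∃ J : KGraph k, J ≤ H ∧ d = f J}.Nonempty := ⟨f H, H, le_rfl, rfl⟩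
  exact ⟨hne.csSup_mem hfin, fun d hd => le_csSup hfin.bddAbove hd⟩

/-- `H` is strictly `k`-balanced. -/
def StrictlyBalanced (H : KGraph k) : Prop := ∀ J : KGraph k, J < H → J.dens < H.mDens

/-- `H₁` is strictly balanced with respect to `d_k(·, H₂)`. -/
def StrictlyBalancedWrt (H₁ H₂ : KGraph k) : Prop :=
  ∀ J : KGraph k, J < H₁ → J.dens₂ H₂ < mDens₂ H₁ H₂

/-- `(H₁, H₂)` is a heart. -/
structure IsHeart (H₁ H₂ : KGraph k) : Prop where
  dens_le : H₂.mDens ≤ H₁.mDens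
  balanced_right : H₂.StrictlyBalanced
  balanced_left_of_eq : H₁.mDens = H₂.mDens → H₁.StrictlyBalanced
  balanced_left_of_lt : H₂.mDens < H₁.mDens → StrictlyBalancedWrt H₁ H₂

/-- `λ(F) = v(F) - e(F) / m_k(H₁, H₂)`. -/
noncomputable def lam (H₁ H₂ F : KGraph k) : ℝ :=
  (F.V.card : ℝ) - (F.E.card : ℝ) / mDens₂ H₁ H₂

/-- `γ = 1 / m_k(H₁, H₂) - 1 / (m_k(H₁, H₂) + ε)`. -/
noncomputable def gam (H₁ H₂ : KGraph k) (ε : ℝ) : ℝ :=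
  1 / mDens₂ H₁ H₂ - 1 / (mDens₂ H₁ H₂ + ε)

/-- The condition of the while-loop: every subhypergraph of `F` with at least one vertex has
`λ > -γ`. -/
def WhileCond (H₁ H₂ : KGraph k) (ε : ℝ) (F : KGraph k) : Prop :=
  ∀ T : KGraph k, T ≤ F → T.V.Nonempty → -gam H₁ H₂ ε < lam H₁ H₂ T

/-- An edge selection rule `elig`, with respect to given notions of open edges and of edges that
belong to a fully open flower: on every `F` with an open edge it selects an open edge of `F`, and
one outside all fully open flowers if there is such an open edge; the selection is unique up to
isomorphism. -/
structure IsEligible (isOpen inFlower : KGraph k → Finset ℕ → Prop)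
    (elig : KGraph k → Finset ℕ) : Prop where
  mem_open : ∀ F : KGraph k, (∃ e ∈ F.E, isOpen F e) → elig F ∈ F.E ∧ isOpen F (elig F)
  avoids_flowers : ∀ F : KGraph k, (∃ e ∈ F.E, isOpen F e ∧ ¬ inFlower F e) →
    ¬ inFlower F (elig F)
  equivariant : ∀ F F' : KGraph k, (∃ e ∈ F.E, isOpen F e) → F.Iso F' →
    ∃ φ : ℕ → ℕ, IsIsoVia φ F F' ∧ (elig F).image φ = elig F'

/-! ### The case `m_k(H₁) > m_k(H₂)` -/

/-- `L ∈ ℒ*_F`: `L` is a copy of `H₂` in `F` such that every edge `e` of `L` is the unique common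
edge of `L` and some copy of `H₁` in `F`. -/
def MemLStar (H₁ H₂ F L : KGraph k) : Prop :=
  L ≤ F ∧ H₂.Iso L ∧ ∀ e ∈ L.E, ∃ R : KGraph k, R ≤ F ∧ H₁.Iso R ∧ L.E ∩ R.E = {e}

/-- The edge `f` is open in `F`. -/
def OpenEdge (H₁ H₂ F : KGraph k) (f : Finset ℕ) : Prop :=
  ¬ ∃ L : KGraph k, MemLStar H₁ H₂ F L ∧ f ∈ L.E

/-- `J` is a fully open flower of `F`: `F` arises from some `k`-graph `G` by attaching a copy `L`
of `H₂` at an edge `e` of `G` and copies `R e'` of `H₁` at all other edges `e'` of `L`, with no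
further intersections, and `J` is what has been attached. -/
def IsFlower (H₁ H₂ F J : KGraph k) : Prop :=
  ∃ (G L : KGraph k) (R : Finset ℕ → KGraph k) (e : Finset ℕ),
    e ∈ G.E ∧ H₂.Iso L ∧ L.E ∩ G.E = {e} ∧ L.V ∩ G.V = e ∧
    (∀ e' ∈ L.E.erase e, H₁.Iso (R e') ∧ (R e').E ∩ (L.E ∪ G.E) = {e'} ∧
      (R e').V ∩ (L.V ∪ G.V) = e') ∧
    (∀ e' ∈ L.E.erase e, ∀ e'' ∈ L.E.erase e, e' ≠ e'' →
      (R e').V ∩ (R e'').V = e' ∩ e'') ∧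
    J = L ∪ iUnionOver (L.E.erase e) R ∧ F = G ∪ J

/-- The edge `f` belongs to a fully open flower of `F`. -/
def InFlower (H₁ H₂ F : KGraph k) (f : Finset ℕ) : Prop :=
  ∃ J : KGraph k, IsFlower H₁ H₂ F J ∧ f ∈ J.E

/-- `F'` is a possible result of `Attach-H₁ (F, v₁, …, v_k)` for some `k` distinct vertices
`v₁, …, v_k` of `F`, whose set is `S`. -/
def AttachH₁ (H₁ F F' : KGraph k) : Prop :=
  ∃ S : Finset ℕ, S ⊆ F.V ∧ S.card = k ∧
    ∃ R : KGraph k, H₁.Iso R ∧ S ⊆ R.V ∧ ¬ R.E ⊆ F.E ∧ F' = F ∪ R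

/-- `F'` is a possible result of `Close-e (F, e)`. -/
def CloseE (H₁ H₂ F : KGraph k) (e : Finset ℕ) (F' : KGraph k) : Prop :=
  ∃ (L : KGraph k) (R : Finset ℕ → KGraph k),
    H₂.Iso L ∧ e ∈ L.E ∧ (∀ e' ∈ L.E \ F.E, (e' ∩ F.V).card < k) ∧
    (∀ e' ∈ L.E \ F.E, H₁.Iso (R e') ∧ L.E ∩ (R e').E = {e'} ∧
      ((R e').V ∩ F.V).card < k) ∧
    F' = F ∪ L ∪ iUnionOver (L.E \ F.E) R

/-- `F'` is a possible result of `Close-e-closededge (F, e)`: as `CloseE`, but at least one new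
edge is added. -/
def CloseEClosed (H₁ H₂ F : KGraph k) (e : Finset ℕ) (F' : KGraph k) : Prop :=
  CloseE H₁ H₂ F e F' ∧ ¬ F'.E ⊆ F.E

/-- One pass through the body of the while-loop of `Grow-B̂_ε`, from `F_i = F` to
`F_{i+1} = F'`. -/
def GrowStep (H₁ H₂ : KGraph k) (ε : ℝ) (elig : KGraph k → Finset ℕ) (F F' : KGraph k) : Prop :=
  WhileCond H₁ H₂ ε F ∧
    (((∃ e ∈ F.E, OpenEdge H₁ H₂ F e) ∧
        (AttachH₁ H₁ F F' ∨ CloseE H₁ H₂ F (elig F) F')) ∨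
      ((¬ ∃ e ∈ F.E, OpenEdge H₁ H₂ F e) ∧
        (AttachH₁ H₁ F F' ∨ ∃ e ∈ F.E, CloseEClosed H₁ H₂ F e F')))

/-- `F` is an output of `Grow-B̂_ε (H₁, H₂, ε)`: some run that starts with `F_0 = H₁` reaches
`F_i = F`, the while-condition holds for `F`, and `F` has no open edge, so that it is returned. -/
def GrowOutput (H₁ H₂ : KGraph k) (ε : ℝ) (elig : KGraph k → Finset ℕ) (F : KGraph k) : Prop :=
  Relation.ReflTransGen (GrowStep H₁ H₂ ε elig) H₁ F ∧ WhileCond H₁ H₂ ε F ∧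
    ¬ ∃ e ∈ F.E, OpenEdge H₁ H₂ F e

/-! ### The case `m_k(H₁) = m_k(H₂)` -/

/-- The edge `f` is open in `F`, in the sense of the case of equal densities. -/
def OpenEdgeAlt (H₁ H₂ F : KGraph k) (f : Finset ℕ) : Prop :=
  ¬ ∃ L R : KGraph k, L ≤ F ∧ R ≤ F ∧ H₂.Iso L ∧ H₁.Iso R ∧ L.E ∩ R.E = {f}

/-- `J` is a fully open flower of `F`, in the sense of the case of equal densities: `F` arises
from some `k`-graph `G` by attaching the copy `J` of `H₁` or `H₂` at an edge `e` of `G`, with no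
further intersections. -/
def IsFlowerAlt (H₁ H₂ F J : KGraph k) : Prop :=
  ∃ (G : KGraph k) (e : Finset ℕ), e ∈ G.E ∧ (H₂.Iso J ∨ H₁.Iso J) ∧
    J.E ∩ G.E = {e} ∧ J.V ∩ G.V = e ∧ F = G ∪ J

/-- The edge `f` belongs to a fully open flower of `F`, in the case of equal densities. -/
def InFlowerAlt (H₁ H₂ F : KGraph k) (f : Finset ℕ) : Prop :=
  ∃ J : KGraph k, IsFlowerAlt H₁ H₂ F J ∧ f ∈ J.E

/-- `F'` is a possible result of `Close-e-Alt (F, e)`. -/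
def CloseEAlt (H₁ H₂ F : KGraph k) (e : Finset ℕ) (F' : KGraph k) : Prop :=
  ∃ L R : KGraph k, H₂.Iso L ∧ H₁.Iso R ∧ L.E ∩ R.E = {e} ∧
    ((R ≤ F ∧ ¬ L ≤ F ∧ F' = F ∪ L) ∨ (L ≤ F ∧ ¬ R ≤ F ∧ F' = F ∪ R))

/-- One pass through the body of the while-loop of `Grow-B̂_ε-Alt`. -/
def GrowStepAlt (H₁ H₂ : KGraph k) (ε : ℝ) (elig : KGraph k → Finset ℕ) (F F' : KGraph k) :
    Prop :=
  WhileCond H₁ H₂ ε F ∧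
    (((∃ e ∈ F.E, OpenEdgeAlt H₁ H₂ F e) ∧ CloseEAlt H₁ H₂ F (elig F) F') ∨
      ((¬ ∃ e ∈ F.E, OpenEdgeAlt H₁ H₂ F e) ∧ ∃ e ∈ F.E, CloseEAlt H₁ H₂ F e F'))

/-- `F` is an output of `Grow-B̂_ε-Alt (H₁, H₂, ε)`. -/
def GrowOutputAlt (H₁ H₂ : KGraph k) (ε : ℝ) (elig : KGraph k → Finset ℕ) (F : KGraph k) :
    Prop :=
  Relation.ReflTransGen (GrowStepAlt H₁ H₂ ε elig) H₁ F ∧ WhileCond H₁ H₂ ε F ∧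
    ¬ ∃ e ∈ F.E, OpenEdgeAlt H₁ H₂ F e

/-! ### The family `B̂(H₁, H₂, ε)` -/

/-- `B̂(H₁, H₂, ε)`, for the choice `elig` of `Eligible-Edge` and the choice `eligAlt` of
`Eligible-Edge-Alt`. -/
def BHat (H₁ H₂ : KGraph k) (ε : ℝ) (elig eligAlt : KGraph k → Finset ℕ) : Set (KGraph k) :=
  {F | (H₂.mDens < H₁.mDens ∧ GrowOutput H₁ H₂ ε elig F) ∨
    (H₁.mDens = H₂.mDens ∧ GrowOutputAlt H₁ H₂ ε eligAlt F)}

/-- A family of `k`-graphs is finite up to isomorphism. -/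
def FiniteUpToIso (B : Set (KGraph k)) : Prop :=
  ∃ S : Set (KGraph k), S.Finite ∧ S ⊆ B ∧ ∀ F ∈ B, ∃ F' ∈ S, F.Iso F'

end KGraph

/-! Put x = 1/m_k(H₂) and y = 1/m_k(H₁,H₂); then λ(F) = v(F) − y e(F) is a weight. Balancedness is
used only through `Tight` and `TightWrt`: a copy has weight exactly k − x (for H₂ with x in place of
y), and its relevant proper subhypergraphs weigh strictly more. When the densities are equal, x = y.

Weights are modular, so no step raises λ, and a step that keeps λ either does nothing or attaches a
fully open flower (`CloseEAlt.wt_lt_or_attached`, `AttachH₁.wt_lt`, `CloseE.trichotomy`). Since y is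
rational, λ takes values in a lattice; an output has λ > −γ, so the number of steps that lower λ is
bounded.

The flower steps are counted by a potential: twice the size of a family of fully open flowers, plus
one if there is a free edge, that is, an open edge outside all fully open flowers. A lowering step
adds at most C vertices, so it spoils at most C flowers with disjoint interiors and costs at most 2C
+ 1. A flower step at e₀ gains at least one. If no flower is spoiled, a flower is gained and at most
the free edge is lost. If e₀ lies in a flower, the rule for eligible edges says that there was no
free edge; the new flower makes up for the one that may be lost, and a third edge of the copy that
contains e₀ can become free. An output has no open edge, hence potential 0. So flower steps number
at most 2C + 1 times the lowering steps, and the order of outputs is bounded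
(`exists_card_le_of_potential`).

The bookkeeping of flowers rests on rigidity: a tight `k`-graph cannot straddle a gluing along an
edge (`Tight.E_subset_or`), and a copy of H₁ cannot straddle the pieces of a star
(`IsStar.exists_le`). Hence attaching a flower creates no unforeseen copies, and its open edges can
be identified. -/

namespace KGraph

variable {k : ℕ}

/-! ### Basic operations -/

@[simp] theorem union_V (F G : KGraph k) : (F ∪ G).V = F.V ∪ G.V := rfl

@[simp] theorem union_E (F G : KGraph k) : (F ∪ G).E = F.E ∪ G.E := rfl

@[simp] theorem iUnionOver_V (S : Finset (Finset ℕ)) (R : Finset ℕ → KGraph k) :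
    (iUnionOver S R).V = S.biUnion fun i => (R i).V := rfl

@[simp] theorem iUnionOver_E (S : Finset (Finset ℕ)) (R : Finset ℕ → KGraph k) :
    (iUnionOver S R).E = S.biUnion fun i => (R i).E := rfl

/-- The common subhypergraph of two `k`-graphs. -/
instance : Inter (KGraph k) where
  inter F G :=
    { V := F.V ∩ G.V
      E := F.E ∩ G.E
      edge_subset := fun e he => Finset.subset_inter
        (F.edge_subset e (Finset.mem_inter.1 he).1) (G.edge_subset e (Finset.mem_inter.1 he).2)
      edge_card := fun e he => F.edge_card e (Finset.mem_inter.1 he).1 }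

@[simp] theorem inter_V (F G : KGraph k) : (F ∩ G).V = F.V ∩ G.V := rfl

@[simp] theorem inter_E (F G : KGraph k) : (F ∩ G).E = F.E ∩ G.E := rfl

theorem le_union_left (F G : KGraph k) : F ≤ F ∪ G :=
  le_iff.2 ⟨Finset.subset_union_left, Finset.subset_union_left⟩

theorem le_union_right (F G : KGraph k) : G ≤ F ∪ G :=
  le_iff.2 ⟨Finset.subset_union_right, Finset.subset_union_right⟩

theorem inter_le_left (F G : KGraph k) : F ∩ G ≤ F :=
  le_iff.2 ⟨Finset.inter_subset_left, Finset.inter_subset_left⟩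

theorem inter_le_right (F G : KGraph k) : F ∩ G ≤ G :=
  le_iff.2 ⟨Finset.inter_subset_right, Finset.inter_subset_right⟩

theorem union_eq_left {F G : KGraph k} (h : G ≤ F) : F ∪ G = F :=
  KGraph.ext (Finset.union_eq_left.2 h.1) (Finset.union_eq_left.2 h.2)

theorem union_assoc' (F G H : KGraph k) : F ∪ G ∪ H = F ∪ (G ∪ H) :=
  KGraph.ext (Finset.union_assoc _ _ _) (Finset.union_assoc _ _ _)

theorem union_right_comm' (F G H : KGraph k) : F ∪ G ∪ H = F ∪ H ∪ G :=
  KGraph.ext (Finset.union_right_comm _ _ _) (Finset.union_right_comm _ _ _)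

theorem eq_of_le_of_card {J H : KGraph k} (h : J ≤ H) (hV : H.V.card ≤ J.V.card)
    (hE : H.E.card ≤ J.E.card) : J = H :=
  KGraph.ext (Finset.eq_of_subset_of_card_le h.1 hV) (Finset.eq_of_subset_of_card_le h.2 hE)

theorem lt_of_le_of_notMem_E {J H : KGraph k} (h : J ≤ H) {f : Finset ℕ} (hf : f ∈ H.E)
    (hf' : f ∉ J.E) : J < H :=
  lt_of_le_of_ne h fun he => hf' (he ▸ hf)

theorem edge_eq_of_subset {F G : KGraph k} {e f : Finset ℕ} (he : e ∈ F.E) (hf : f ∈ G.E)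
    (h : e ⊆ f) : e = f :=
  Finset.eq_of_subset_of_card_le h (by rw [F.edge_card e he, G.edge_card f hf])

theorem le_card_V {F : KGraph k} {e : Finset ℕ} (he : e ∈ F.E) : k ≤ F.V.card := by
  exact (F.edge_card e he).ge.trans (Finset.card_le_card (F.edge_subset e he))

theorem succ_le_card {S e f : Finset ℕ} (he : e.card = k) (hf : f.card = k) (hne : e ≠ f)
    (heS : e ⊆ S) (hfS : f ⊆ S) : k + 1 ≤ S.card := by
  by_contra h
  have h1 : S.card ≤ k := by omega
  exact hne ((Finset.eq_of_subset_of_card_le heS (by omega)).trans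
    (Finset.eq_of_subset_of_card_le hfS (by omega)).symm)

/-- The `k`-graph with vertex set `V` and edge set `E`, where `E` consists of edges of `H`. -/
def sub (H : KGraph k) (V : Finset ℕ) (E : Finset (Finset ℕ)) (hE : E ⊆ H.E)
    (hV : ∀ e ∈ E, e ⊆ V) : KGraph k where
  V := V
  E := E
  edge_subset := hV
  edge_card := fun e he => H.edge_card e (hE he)

theorem sub_le (H : KGraph k) {V : Finset ℕ} {E : Finset (Finset ℕ)} (hE : E ⊆ H.E)
    (hV : ∀ e ∈ E, e ⊆ V) (hVH : V ⊆ H.V) : H.sub V E hE hV ≤ H :=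
  le_iff.2 ⟨hVH, hE⟩

/-! ### Isomorphism -/

theorem image_injOn_of_injOn {φ : ℕ → ℕ} {V : Finset ℕ} (h : Set.InjOn φ V) {e f : Finset ℕ}
    (he : e ⊆ V) (hf : f ⊆ V) (hef : e.image φ = f.image φ) : e = f := by
  have key : ∀ {e f : Finset ℕ}, e ⊆ V → f ⊆ V → e.image φ = f.image φ → e ⊆ f := by
    intro e f he hf hef u hu
    have : φ u ∈ f.image φ := hef ▸ Finset.mem_image_of_mem φ hu
    obtain ⟨w, hw, hwu⟩ := Finset.mem_image.1 this
    exact h (hf hw) (he hu) hwu ▸ hw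
  exact (key he hf hef).antisymm (key hf he hef.symm)

theorem IsIsoVia.injOn_E {φ : ℕ → ℕ} {F F' : KGraph k} (h : IsIsoVia φ F F') :
    Set.InjOn (fun e : Finset ℕ => e.image φ) F.E := fun e he f hf hef =>
  image_injOn_of_injOn h.1 (F.edge_subset e he) (F.edge_subset f hf) hef

theorem Iso.card_V {F F' : KGraph k} (h : F.Iso F') : F'.V.card = F.V.card := by
  obtain ⟨φ, hφ⟩ := h
  rw [hφ.2.1, Finset.card_image_of_injOn hφ.1]

theorem Iso.card_E {F F' : KGraph k} (h : F.Iso F') : F'.E.card = F.E.card := by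
  obtain ⟨φ, hφ⟩ := h
  rw [hφ.2.2, Finset.card_image_of_injOn hφ.injOn_E]

theorem Iso.refl (F : KGraph k) : F.Iso F :=
  ⟨id, Set.injOn_id _, by simp, by simp⟩

theorem Iso.symm {F F' : KGraph k} (h : F.Iso F') : F'.Iso F := by
  obtain ⟨φ, h1, h2, h3⟩ := h
  have hinv : ∀ e ⊆ F.V, (e.image φ).image (Function.invFunOn φ F.V) = e := by
    intro e he
    rw [Finset.image_image]
    conv_rhs => rw [← Finset.image_id (s := e)]
    exact Finset.image_congr fun u hu => h1.leftInvOn_invFunOn (he hu)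
  refine ⟨Function.invFunOn φ F.V, ?_, ?_, ?_⟩
  · rw [h2]
    intro a ha b hb hab
    obtain ⟨u, hu, rfl⟩ := Finset.mem_image.1 (Finset.mem_coe.1 ha)
    obtain ⟨w, hw, rfl⟩ := Finset.mem_image.1 (Finset.mem_coe.1 hb)
    rw [h1.leftInvOn_invFunOn hu, h1.leftInvOn_invFunOn hw] at hab
    rw [hab]
  · rw [h2, hinv _ subset_rfl]
  · rw [h3, Finset.image_image]
    conv_lhs => rw [← Finset.image_id (s := F.E)]
    exact Finset.image_congr fun e he => (hinv e (F.edge_subset e he)).symm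

theorem Iso.trans {F F' F'' : KGraph k} (h : F.Iso F') (h' : F'.Iso F'') : F.Iso F'' := by
  obtain ⟨φ, h1, h2, h3⟩ := h
  obtain ⟨ψ, g1, g2, g3⟩ := h'
  refine ⟨ψ ∘ φ, ?_, ?_, ?_⟩
  · refine g1.comp h1 fun u hu => ?_
    rw [h2]; exact Finset.mem_coe.2 (Finset.mem_image_of_mem φ hu)
  · rw [g2, h2, Finset.image_image]
  · rw [g3, h3, Finset.image_image]
    exact Finset.image_congr fun e _ => by simp [Finset.image_image]

/-- Subhypergraphs of a copy of `H` correspond to subhypergraphs of `H`. -/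
theorem Iso.exists_le {H T K : KGraph k} (h : H.Iso T) (hK : K ≤ T) :
    ∃ K' ≤ H, K'.V.card = K.V.card ∧ K'.E.card = K.E.card := by
  obtain ⟨φ, hφ⟩ := h.symm
  refine ⟨⟨K.V.image φ, K.E.image fun e => e.image φ, ?_, ?_⟩, ?_, ?_, ?_⟩
  · intro e he
    obtain ⟨f, hf, rfl⟩ := Finset.mem_image.1 he
    exact Finset.image_subset_image (K.edge_subset f hf)
  · intro e he
    obtain ⟨f, hf, rfl⟩ := Finset.mem_image.1 he
    rw [Finset.card_image_of_injOn (hφ.1.mono (Finset.coe_subset.2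
      ((K.edge_subset f hf).trans hK.1))), K.edge_card f hf]
  · exact le_iff.2 ⟨(Finset.image_subset_image hK.1).trans hφ.2.1.ge,
      (Finset.image_subset_image hK.2).trans hφ.2.2.ge⟩
  · exact Finset.card_image_of_injOn (hφ.1.mono (Finset.coe_subset.2 hK.1))
  · exact Finset.card_image_of_injOn (hφ.injOn_E.mono (Finset.coe_subset.2 hK.2))

theorem Iso.exists_lt {H T K : KGraph k} (h : H.Iso T) (hK : K < T) :
    ∃ K' < H, K'.V.card = K.V.card ∧ K'.E.card = K.E.card := by
  obtain ⟨K', hK', hV, hE⟩ := h.exists_le hK.le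
  refine ⟨K', lt_of_le_of_ne hK' fun he => hK.ne ?_, hV, hE⟩
  subst he
  exact eq_of_le_of_card hK.le (by rw [← hV, h.card_V]) (by rw [← hE, h.card_E])

theorem eq_of_le_of_iso {H S T : KGraph k} (h : S ≤ T) (hS : H.Iso S) (hT : H.Iso T) : S = T :=
  eq_of_le_of_card h (by rw [hS.card_V, hT.card_V]) (by rw [hS.card_E, hT.card_E])

theorem exists_iso_range (F : KGraph k) : ∃ G : KGraph k, F.Iso G ∧ G.V = Finset.range F.V.card := by
  have e := F.V.equivFin
  let φ : ℕ → ℕ := fun u => if h : u ∈ F.V then e ⟨u, h⟩ else 0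
  have hφ : ∀ u (h : u ∈ F.V), φ u = e ⟨u, h⟩ := fun u h => by simp [φ, h]
  have hinj : Set.InjOn φ F.V := by
    intro a ha b hb hab
    rw [hφ a ha, hφ b hb] at hab
    simpa using e.injective (Fin.ext hab)
  refine ⟨⟨F.V.image φ, F.E.image fun f => f.image φ, ?_, ?_⟩, ⟨φ, hinj, rfl, rfl⟩, ?_⟩
  · intro f hf
    obtain ⟨g, hg, rfl⟩ := Finset.mem_image.1 hf
    exact Finset.image_subset_image (F.edge_subset g hg)
  · intro f hf
    obtain ⟨g, hg, rfl⟩ := Finset.mem_image.1 hf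
    rw [Finset.card_image_of_injOn (hinj.mono (Finset.coe_subset.2 (F.edge_subset g hg))),
      F.edge_card g hg]
  · refine Finset.eq_of_subset_of_card_le ?_ ?_
    · intro u hu
      obtain ⟨w, hw, rfl⟩ := Finset.mem_image.1 hu
      rw [hφ w hw]
      simp
    · rw [Finset.card_image_of_injOn hinj, Finset.card_range]

/-- A family of `k`-graphs of bounded order is finite up to isomorphism. -/
theorem finiteUpToIso_of_card_le {B : Set (KGraph k)} {n : ℕ} (h : ∀ F ∈ B, F.V.card ≤ n) :
    FiniteUpToIso B := by
  classical
  let 𝒢 : Set (KGraph k) := {G | G.V ⊆ Finset.range n ∧ ∃ F ∈ B, F.Iso G}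
  have hfin : 𝒢.Finite := by
    refine Set.Finite.of_finite_image (f := fun G => (G.V, G.E))
      (((Finset.range n).powerset ×ˢ (Finset.range n).powerset.powerset).finite_toSet.subset ?_) ?_
    · rintro _ ⟨G, ⟨hG, -⟩, rfl⟩
      simp only [Finset.coe_product, Set.mem_prod, Finset.mem_coe, Finset.mem_powerset]
      exact ⟨hG, fun e he => Finset.mem_powerset.2 ((G.edge_subset e he).trans hG)⟩
    · intro F _ G _ h
      exact KGraph.ext (congrArg Prod.fst h) (congrArg Prod.snd h)
  -- Representatives must lie in `B` itself, so each relabelled graph is traded back for a member of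
  -- `B`.
  have hex : ∀ G : KGraph k, ∃ F : KGraph k, G ∈ 𝒢 → F ∈ B ∧ F.Iso G := by
    intro G
    by_cases hG : G ∈ 𝒢
    · obtain ⟨F, hF, hFG⟩ := hG.2
      exact ⟨F, fun _ => ⟨hF, hFG⟩⟩
    · exact ⟨G, fun h => absurd h hG⟩
  choose r hr using hex
  refine ⟨r '' 𝒢, hfin.image r, ?_, ?_⟩
  · rintro _ ⟨G, hG, rfl⟩
    exact (hr G hG).1
  · intro F hF
    obtain ⟨G, hFG, hG⟩ := F.exists_iso_range
    have hG' : G ∈ 𝒢 := ⟨by rw [hG]; exact Finset.range_subset_range.2 (h F hF), F, hF, hFG⟩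
    exact ⟨r G, ⟨G, hG', rfl⟩, hFG.trans (hr G hG').2.symm⟩

/-! ### Weights and tight `k`-graphs -/

/-- The weight `v(F) - a e(F)`. -/
noncomputable def wt (a : ℝ) (F : KGraph k) : ℝ := (F.V.card : ℝ) - a * F.E.card

theorem wt_union_add_wt_inter (a : ℝ) (F G : KGraph k) :
    wt a (F ∪ G) + wt a (F ∩ G) = wt a F + wt a G := by
  have h1 : ((F.V ∪ G.V).card : ℝ) + (F.V ∩ G.V).card = F.V.card + G.V.card := by
    exact_mod_cast Finset.card_union_add_card_inter F.V G.V
  have h2 : ((F.E ∪ G.E).card : ℝ) + (F.E ∩ G.E).card = F.E.card + G.E.card := by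
    exact_mod_cast Finset.card_union_add_card_inter F.E G.E
  simp only [wt, union_V, union_E, inter_V, inter_E]
  linear_combination h1 - a * h2

/-- What strict `k`-balancedness of `T` with `m_k(T) = 1 / x` amounts to. -/
structure Tight (x : ℝ) (T : KGraph k) : Prop where
  three_le : 3 ≤ T.E.card
  wt_eq : wt x T = k - x
  lt_wt : ∀ K < T, K.E.Nonempty → k + 1 ≤ K.V.card → k - x < wt x K

/-- What strict balancedness of `T` with respect to `d_k(·, H₂)` amounts to, where
`m_k(H₂) = 1 / x` and `m_k(T, H₂) = 1 / y`. -/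
structure TightWrt (x y : ℝ) (T : KGraph k) : Prop where
  three_le : 3 ≤ T.E.card
  wt_eq : wt y T = k - x
  lt_wt : ∀ K < T, k ≤ K.V.card → k - x < wt y K

theorem Tight.iso {x : ℝ} {H T : KGraph k} (hH : Tight x H) (h : H.Iso T) : Tight x T where
  three_le := by rw [h.card_E]; exact hH.three_le
  wt_eq := by rw [wt, h.card_E, h.card_V]; exact hH.wt_eq
  lt_wt := by
    intro K hK hKE hKV
    obtain ⟨K', hK', hV, hE⟩ := h.exists_lt hK
    have := hH.lt_wt K' hK' (by rw [← Finset.card_pos, hE, Finset.card_pos]; exact hKE)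
      (by rw [hV]; exact hKV)
    rwa [wt, hV, hE] at this

theorem TightWrt.iso {x y : ℝ} {H T : KGraph k} (hH : TightWrt x y H) (h : H.Iso T) :
    TightWrt x y T where
  three_le := by rw [h.card_E]; exact hH.three_le
  wt_eq := by rw [wt, h.card_E, h.card_V]; exact hH.wt_eq
  lt_wt := by
    intro K hK hKV
    obtain ⟨K', hK', hV, hE⟩ := h.exists_lt hK
    have := hH.lt_wt K' hK' (by rw [hV]; exact hKV)
    rwa [wt, hV, hE] at this

/-- The case left out of `Tight.lt_wt`, an edge on only k vertices, is a single edge, of weight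
exactly k − x. So k − x is the minimum over all subhypergraphs with an edge. -/
theorem Tight.le_wt {x : ℝ} {T K : KGraph k} (hT : Tight x T) (hK : K ≤ T)
    (hE : K.E.Nonempty) : k - x ≤ wt x K := by
  rcases hK.eq_or_lt with rfl | hlt
  · exact hT.wt_eq.ge
  by_cases hV : k + 1 ≤ K.V.card
  · exact (hT.lt_wt K hlt hE hV).le
  · obtain ⟨e, he⟩ := hE
    have hVk : K.V.card = k := by have := le_card_V he; omega
    have : K.E = {e} := by
      refine Finset.eq_singleton_iff_unique_mem.2 ⟨he, fun f hf => ?_⟩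
      by_contra hne
      exact hV (succ_le_card (K.edge_card f hf) (K.edge_card e he) hne (K.edge_subset f hf)
        (K.edge_subset e he))
    rw [wt, hVk, this]; simp

/-! ### How tight `k`-graphs sit inside unions -/

theorem exists_mem_ne_ne {S : Finset (Finset ℕ)} (h : 3 ≤ S.card) (a b : Finset ℕ) :
    ∃ f ∈ S, f ≠ a ∧ f ≠ b := by
  have h1 : 0 < ((S.erase a).erase b).card := by
    have := Finset.pred_card_le_card_erase (s := S) (a := a)
    have := Finset.pred_card_le_card_erase (s := S.erase a) (a := b)
    omega
  obtain ⟨f, hf⟩ := Finset.card_pos.1 h1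
  simp only [Finset.mem_erase] at hf
  exact ⟨f, hf.2.2, hf.2.1, hf.1⟩

theorem nonempty_of_three_le {S : Finset (Finset ℕ)} (h : 3 ≤ S.card) : S.Nonempty :=
  Finset.card_pos.1 (by omega)

/-- In a tight `k`-graph every vertex lies in an edge different from any given one. -/
theorem Tight.exists_edge_ne {x : ℝ} (hx : 0 < x) (hx1 : x < 1) {T : KGraph k} (hT : Tight x T)
    {u : ℕ} (hu : u ∈ T.V) (f : Finset ℕ) : ∃ g ∈ T.E, g ≠ f ∧ u ∈ g := by
  by_contra! hcon
  -- Deleting u and f costs one vertex and at most one edge, so the weight falls by at least 1 − x >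
  -- 0, below the minimum k − x.
  have hE : ∀ e ∈ T.E.erase f, e ⊆ T.V.erase u := fun e he => Finset.subset_erase.2
    ⟨T.edge_subset e (Finset.mem_of_mem_erase he),
      hcon e (Finset.mem_of_mem_erase he) (Finset.ne_of_mem_erase he)⟩
  obtain ⟨g, hg, hgf, -⟩ := exists_mem_ne_ne hT.three_le f f
  have h := hT.le_wt (T.sub_le (Finset.erase_subset _ _) hE (Finset.erase_subset _ _))
    ⟨g, Finset.mem_erase.2 ⟨hgf, hg⟩⟩
  have h2 := hT.wt_eq
  simp only [wt, sub] at h h2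
  rw [Finset.cast_card_erase_of_mem hu] at h
  have h3 : (T.E.card : ℝ) ≤ (T.E.erase f).card + 1 := by
    have := Finset.pred_card_le_card_erase (s := T.E) (a := f)
    exact_mod_cast (by omega : T.E.card ≤ (T.E.erase f).card + 1)
  nlinarith

theorem Tight.le_of_E_subset {x : ℝ} (hx : 0 < x) (hx1 : x < 1) {T F : KGraph k}
    (hT : Tight x T) (h : T.E ⊆ F.E) : T ≤ F :=
  le_iff.2 ⟨fun _ hu =>
    have ⟨g, hg, _, hug⟩ := hT.exists_edge_ne hx hx1 hu ∅
    F.edge_subset g (h hg) hug, h⟩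

/-- A tight `k`-graph in the union of `G` and `L`, which is tight as well, where `G` and `L` meet
in an edge only, lies in one of the two. -/
theorem Tight.E_subset_or {x : ℝ} (hx : 0 < x) (hx1 : x < 1) {T G L : KGraph k} {e : Finset ℕ}
    (hT : Tight x T) (hL : Tight x L) (he : e ∈ G.E) (heL : e ∈ L.E) (hV : L.V ∩ G.V = e)
    (hTE : T.E ⊆ G.E ∪ L.E) : T.E ⊆ G.E ∨ T.E ⊆ L.E := by
  by_contra! hcon
  obtain ⟨g, hgT, hgG⟩ := Finset.not_subset.1 hcon.1
  obtain ⟨f, hfT, hfL⟩ := Finset.not_subset.1 hcon.2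
  have hgL : g ∈ L.E := (Finset.mem_union.1 (hTE hgT)).resolve_left hgG
  have hfG : f ∈ G.E := (Finset.mem_union.1 (hTE hfT)).resolve_right hfL
  have hfe : f ≠ e := fun h => hfL (h ▸ heL)
  have hTle : T ≤ G ∪ L := hT.le_of_E_subset hx hx1 hTE
  have hcover : (T ∩ G) ∪ (T ∩ L) = T := by
    refine KGraph.ext ?_ ?_
    · change T.V ∩ G.V ∪ T.V ∩ L.V = T.V
      rw [← Finset.inter_union_distrib_left]; exact Finset.inter_eq_left.2 hTle.1
    · change T.E ∩ G.E ∪ T.E ∩ L.E = T.E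
      rw [← Finset.inter_union_distrib_left]; exact Finset.inter_eq_left.2 hTle.2
  have hsum := wt_union_add_wt_inter x (T ∩ G) (T ∩ L)
  rw [hcover, hT.wt_eq] at hsum
  have hIV : ((T ∩ G) ∩ (T ∩ L)).V = T.V ∩ e := by
    rw [← hV]; ext u; simp; tauto
  have hIE : ((T ∩ G) ∩ (T ∩ L)).E = T.E ∩ {e} := by
    have : G.E ∩ L.E = {e} := by
      refine Finset.eq_singleton_iff_unique_mem.2 ⟨Finset.mem_inter.2 ⟨he, heL⟩, fun h hh => ?_⟩
      obtain ⟨h1, h2⟩ := Finset.mem_inter.1 hh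
      refine edge_eq_of_subset h1 he ?_
      rw [← hV]
      exact Finset.subset_inter (L.edge_subset h h2) (G.edge_subset h h1)
    rw [← this]; ext u; simp; tauto
  have hwI : wt x ((T ∩ G) ∩ (T ∩ L)) = ((T.V ∩ e).card : ℝ) - x * (T.E ∩ {e}).card := by
    rw [wt, hIV, hIE]
  have hG1 := hT.le_wt (inter_le_left T G) ⟨f, Finset.mem_inter.2 ⟨hfT, hfG⟩⟩
  -- By modularity wt T is the sum of the weights of the two parts minus that of their intersection;
  -- either way it will exceed k − x.
  by_cases heT : e ⊆ T.V
  · have hG2 : k - x < wt x (T ∩ G) := by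
      refine hT.lt_wt _ (lt_of_le_of_notMem_E (inter_le_left T G) hgT
        fun h => hgG (Finset.mem_inter.1 h).2) ⟨f, Finset.mem_inter.2 ⟨hfT, hfG⟩⟩ ?_
      exact succ_le_card (G.edge_card f hfG) (G.edge_card e he) hfe
        (Finset.subset_inter (T.edge_subset f hfT) (G.edge_subset f hfG))
        (Finset.subset_inter heT (G.edge_subset e he))
    -- The edge e may be missing from T. Adding it to T ∩ L allows tightness of L to be used, and
    -- the extra x is exactly what the weight of the intersection compensates.
    have hsubE : insert e (T.E ∩ L.E) ⊆ L.E :=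
      Finset.insert_subset heL Finset.inter_subset_right
    have hsubV : ∀ h ∈ insert e (T.E ∩ L.E), h ⊆ T.V ∩ L.V := by
      intro h hh
      rcases Finset.mem_insert.1 hh with rfl | hh
      · exact Finset.subset_inter heT (L.edge_subset _ heL)
      · exact (T ∩ L).edge_subset h hh
    have hL1 := hL.le_wt (L.sub_le hsubE hsubV Finset.inter_subset_right)
      ⟨e, Finset.mem_insert_self _ _⟩
    have hk : ((T.V ∩ e).card : ℝ) = k := by
      rw [Finset.inter_eq_right.2 heT, G.edge_card e he]
    have hins : ((insert e (T.E ∩ L.E)).card : ℝ) + (T.E ∩ {e}).card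
        = (T.E ∩ L.E).card + 1 := by
      by_cases heTE : e ∈ T.E
      · rw [Finset.insert_eq_self.2 (Finset.mem_inter.2 ⟨heTE, heL⟩),
          Finset.inter_singleton_of_mem heTE]; simp
      · rw [Finset.card_insert_of_notMem (fun h => heTE (Finset.mem_inter.1 h).1),
          Finset.inter_singleton_of_notMem heTE]; simp
    rw [hwI, hk] at hsum
    simp only [wt, sub, inter_V, inter_E] at hL1 hsum hG2
    nlinarith
  -- The parts share at most k − 1 vertices, so wt T ≥ 2(k − x) − (k − 1), which exceeds k − x
  -- because x < 1.
  · have hL1 := hT.le_wt (inter_le_left T L) ⟨g, Finset.mem_inter.2 ⟨hgT, hgL⟩⟩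
    have hk : ((T.V ∩ e).card : ℝ) + 1 ≤ k := by
      have : (T.V ∩ e).card < e.card := Finset.card_lt_card
        ⟨Finset.inter_subset_right, fun h => heT (h.trans Finset.inter_subset_left)⟩
      rw [G.edge_card e he] at this
      exact_mod_cast this
    have : (0 : ℝ) ≤ x * (T.E ∩ {e}).card := by positivity
    rw [hwI] at hsum
    linarith

/-! ### Weights from densities -/

/-- A density above 1 is neither of the default values 1/k and 0, and e − 1 > v − k ≥ 1 forces three
edges. The third edge is what later survives the use of two others. -/
theorem one_lt_of_one_lt_dens (hk : 2 ≤ k) {J : KGraph k} (h : 1 < J.dens) :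
    J.E.Nonempty ∧ k + 1 ≤ J.V.card ∧
      J.dens = ((J.E.card : ℝ) - 1) / ((J.V.card : ℝ) - k) ∧ 3 ≤ J.E.card := by
  unfold dens at h ⊢
  split_ifs at h ⊢ with h1 h2
  · refine ⟨h1.1, h1.2, rfl, ?_⟩
    have hv : (1 : ℝ) ≤ (J.V.card : ℝ) - k := by
      have : ((k + 1 : ℕ) : ℝ) ≤ J.V.card := by exact_mod_cast h1.2
      push_cast at this; linarith
    rw [lt_div_iff₀ (by linarith)] at h
    have : (2 : ℝ) < J.E.card := by linarith
    exact_mod_cast this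
  · exfalso
    have : (2 : ℝ) ≤ k := by exact_mod_cast hk
    rw [lt_div_iff₀ (by linarith)] at h
    linarith
  · linarith

theorem StrictlyBalanced.dens_eq {H : KGraph k} (hH : H.StrictlyBalanced) : H.dens = H.mDens := by
  obtain ⟨J, hJ, hd⟩ := (isGreatest_sSup_subgraphs H dens).1
  change H.mDens = J.dens at hd
  rcases hJ.eq_or_lt with rfl | hlt
  · exact hd.symm
  · exact absurd hd (hH J hlt).ne'

theorem dens₂_le_mDens₂ {J H₁ H₂ : KGraph k} (h : J ≤ H₁) : J.dens₂ H₂ ≤ mDens₂ H₁ H₂ :=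
  (isGreatest_sSup_subgraphs H₁ fun J => J.dens₂ H₂).2 ⟨J, h, rfl⟩

theorem StrictlyBalanced.tight (hk : 2 ≤ k) {H : KGraph k} (hH : H.StrictlyBalanced)
    (h1 : 1 < H.mDens) : Tight (1 / H.mDens) H := by
  have hd := hH.dens_eq
  obtain ⟨-, hV, hdens, h3⟩ := one_lt_of_one_lt_dens hk (hd ▸ h1)
  have hv : (0 : ℝ) < (H.V.card : ℝ) - k := by
    have : (k : ℝ) < H.V.card := by exact_mod_cast hV
    linarith
  have hm : (0 : ℝ) < H.mDens := by linarith
  rw [hd, eq_div_iff hv.ne'] at hdens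
  refine ⟨h3, ?_, ?_⟩
  · rw [wt]
    field_simp
    linarith
  · intro K hK hKE hKV
    have hlt := hH K hK
    have hKv : (0 : ℝ) < (K.V.card : ℝ) - k := by
      have : (k : ℝ) < K.V.card := by exact_mod_cast hKV
      linarith
    rw [dens, if_pos ⟨hKE, hKV⟩, div_lt_iff₀ hKv] at hlt
    rw [wt]
    have : (K.E.card : ℝ) * (1 / H.mDens) < (K.V.card : ℝ) - k + 1 / H.mDens := by
      rw [mul_one_div, div_lt_iff₀ hm, add_mul, one_div_mul_cancel hm.ne']
      linarith
    linarith

/-- Rationality of 1/m_k(H), the source of the discreteness of the weight. -/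
theorem StrictlyBalanced.exists_int (hk : 2 ≤ k) {H : KGraph k} (hH : H.StrictlyBalanced)
    (h1 : 1 < H.mDens) : ((H.E.card : ℝ) - 1) * (1 / H.mDens) = (H.V.card : ℝ) - k := by
  have := (hH.tight hk h1).wt_eq
  rw [wt] at this
  linarith

/-- The subhypergraph consisting of a single edge. -/
theorem exists_single_edge {H : KGraph k} {e : Finset ℕ} (he : e ∈ H.E) :
    ∃ J ≤ H, J.V = e ∧ J.E = {e} :=
  ⟨H.sub e {e} (Finset.singleton_subset_iff.2 he) (by simp),
    H.sub_le _ _ (H.edge_subset e he), rfl, rfl⟩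

theorem dens₂_single_edge {J H₂ : KGraph k} {e : Finset ℕ} (hV : J.V = e) (hE : J.E = {e})
    (h₂ : H₂.E.Nonempty) : J.dens₂ H₂ = H₂.mDens := by
  have hc : J.V.card = k := by rw [hV]; exact J.edge_card e (by simp [hE])
  rw [dens₂, if_pos ⟨h₂, hc.ge⟩, hE, hc]
  simp

/-- A single edge is a proper subhypergraph of H₁ with d_k(·, H₂) = m_k(H₂), so strict balancedness
separates the two values; this gives y < x. -/
theorem mDens₂_gt (hk : 2 ≤ k) {H₁ H₂ : KGraph k} (h : IsHeart H₁ H₂) (h1 : 1 < H₂.mDens)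
    (hlt : H₂.mDens < H₁.mDens) : 3 ≤ H₁.E.card ∧ H₂.mDens < mDens₂ H₁ H₂ := by
  obtain ⟨J, hJ, hd⟩ := (isGreatest_sSup_subgraphs H₁ dens).1
  change H₁.mDens = J.dens at hd
  obtain ⟨-, -, -, h3⟩ := one_lt_of_one_lt_dens hk (by rw [← hd]; linarith : 1 < J.dens)
  have h3' : 3 ≤ H₁.E.card := h3.trans (Finset.card_le_card hJ.2)
  refine ⟨h3', ?_⟩
  obtain ⟨e, he⟩ := nonempty_of_three_le h3'
  obtain ⟨I, hI, hIV, hIE⟩ := exists_single_edge he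
  have hIlt : I < H₁ := lt_of_le_of_ne hI fun h => by
    rw [← h, hIE] at h3'; simp at h3'
  rw [← dens₂_single_edge hIV hIE
    (nonempty_of_three_le (h.balanced_right.tight hk h1).three_le)]
  exact h.balanced_left_of_lt hlt I hIlt

theorem IsHeart.tightWrt (hk : 2 ≤ k) {H₁ H₂ : KGraph k} (h : IsHeart H₁ H₂)
    (h1 : 1 < H₂.mDens) (hlt : H₂.mDens < H₁.mDens) :
    TightWrt (1 / H₂.mDens) (1 / mDens₂ H₁ H₂) H₁ := by
  obtain ⟨h3, hm⟩ := mDens₂_gt hk h h1 hlt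
  have h₂ := nonempty_of_three_le (h.balanced_right.tight hk h1).three_le
  have hx : 0 < 1 / H₂.mDens := by positivity
  have hm0 : 0 < mDens₂ H₁ H₂ := by linarith
  have hpos : ∀ K : KGraph k, k ≤ K.V.card → 0 < (K.V.card : ℝ) - k + 1 / H₂.mDens := by
    intro K hK
    have : (k : ℝ) ≤ K.V.card := by exact_mod_cast hK
    linarith
  have hV : k ≤ H₁.V.card := by
    obtain ⟨e, he⟩ := nonempty_of_three_le h3
    exact le_card_V he
  refine ⟨h3, ?_, ?_⟩
  · have hd : H₁.dens₂ H₂ = mDens₂ H₁ H₂ := by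
      obtain ⟨J, hJ, hd⟩ := (isGreatest_sSup_subgraphs H₁ fun J => J.dens₂ H₂).1
      change mDens₂ H₁ H₂ = J.dens₂ H₂ at hd
      rcases hJ.eq_or_lt with rfl | hJlt
      · exact hd.symm
      · exact absurd hd (h.balanced_left_of_lt hlt J hJlt).ne'
    rw [dens₂, if_pos ⟨h₂, hV⟩, div_eq_iff (hpos _ hV).ne'] at hd
    have : 1 / mDens₂ H₁ H₂ * (H₁.E.card : ℝ) = (H₁.V.card : ℝ) - k + 1 / H₂.mDens := by
      rw [hd, ← mul_assoc, one_div_mul_cancel hm0.ne', one_mul]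
    rw [wt]
    linarith
  · intro K hK hKV
    have hd := h.balanced_left_of_lt hlt K hK
    rw [dens₂, if_pos ⟨h₂, hKV⟩, div_lt_iff₀ (hpos _ hKV)] at hd
    have : (K.E.card : ℝ) * (1 / mDens₂ H₁ H₂) < (K.V.card : ℝ) - k + 1 / H₂.mDens := by
      rw [mul_one_div, div_lt_iff₀ hm0]
      linarith
    rw [wt]
    linarith

/-- Tightness of H₁ is precisely the upper bound, and a single edge attains it; so one weight serves
both graphs. -/
theorem IsHeart.mDens₂_eq (hk : 2 ≤ k) {H₁ H₂ : KGraph k} (h : IsHeart H₁ H₂)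
    (h1 : 1 < H₂.mDens) (heq : H₁.mDens = H₂.mDens) : mDens₂ H₁ H₂ = H₂.mDens := by
  have ht := (h.balanced_left_of_eq heq).tight hk (heq ▸ h1)
  rw [heq] at ht
  have h₂ := nonempty_of_three_le (h.balanced_right.tight hk h1).three_le
  have hm : 0 < H₂.mDens := by linarith
  refine le_antisymm ?_ ?_
  · obtain ⟨J, hJ, hd⟩ := (isGreatest_sSup_subgraphs H₁ fun J => J.dens₂ H₂).1
    change mDens₂ H₁ H₂ = J.dens₂ H₂ at hd
    rw [hd, dens₂]
    split_ifs with hc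
    · have hv : (k : ℝ) ≤ J.V.card := by exact_mod_cast hc.2
      have hx : 0 < 1 / H₂.mDens := by positivity
      rcases J.E.eq_empty_or_nonempty with hE | hE
      · rw [hE]; simp [hm.le]
      · have := ht.le_wt hJ hE
        rw [wt] at this
        rw [div_le_iff₀ (by linarith)]
        have h2 : (J.E.card : ℝ) * (1 / H₂.mDens) ≤ (J.V.card : ℝ) - k + 1 / H₂.mDens := by
          linarith
        rw [mul_one_div, div_le_iff₀ hm] at h2
        linarith
    · exact hm.le
  · obtain ⟨e, he⟩ := nonempty_of_three_le ht.three_le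
    obtain ⟨I, hI, hIV, hIE⟩ := exists_single_edge he
    rw [← dens₂_single_edge hIV hIE h₂]
    exact dens₂_le_mDens₂ hI

/-! ### Bounding the length of a run by a potential -/

/-- `Ψ F n` reads "the potential of F is at least n". Weight drops are limited by the lattice
spacing 1/N and the lower bound −b; each costs at most K of potential, every other proper step earns
at least 1, and nothing is left at the end. -/
theorem exists_card_le_of_potential {step : KGraph k → KGraph k → Prop} {P : KGraph k → Prop}
    {Ψ : KGraph k → ℕ → Prop} {F₀ : KGraph k} {y b : ℝ} {N C K : ℕ} {p : ℤ}
    (hN : 0 < N) (hp : (N : ℝ) * y = p) (hP : P F₀) (hΨ : Ψ F₀ 0)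
    (hstep : ∀ F F', P F → step F F' → P F' ∧ (F' = F ∨ F'.V.card ≤ F.V.card + C ∧
      ((wt y F' < wt y F ∧ ∀ n, Ψ F n → Ψ F' (n - K)) ∨
        (wt y F' ≤ wt y F ∧ ∀ n, Ψ F n → Ψ F' (n + 1))))) :
    ∃ B : ℕ, ∀ F, Relation.ReflTransGen step F₀ F →
      (P F → -b < wt y F ∧ ∀ n, Ψ F n → n = 0) → F.V.card ≤ B := by
  have hN' : (0 : ℝ) < N := by exact_mod_cast hN
  have hμ : ∃ μ : KGraph k → ℤ, ∀ F, (μ F : ℝ) = N * wt y F := by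
    refine ⟨fun F => N * F.V.card - p * F.E.card, fun F => ?_⟩
    push_cast
    rw [wt, ← hp]; ring
  obtain ⟨μ, hμ⟩ := hμ
  have hμlt : ∀ F F', wt y F' < wt y F → μ F' + 1 ≤ μ F := by
    intro F F' h
    have : (μ F' : ℝ) < μ F := by rw [hμ, hμ]; exact mul_lt_mul_of_pos_left h hN'
    exact_mod_cast this
  have hμle : ∀ F F', wt y F' ≤ wt y F → μ F' ≤ μ F := by
    intro F F' h
    have : (μ F' : ℝ) ≤ μ F := by rw [hμ, hμ]; exact mul_le_mul_of_nonneg_left h hN'.le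
    exact_mod_cast this
  -- Here q counts the weight drops and s the remaining proper steps; truncation in n − K only helps
  -- the bound s ≤ n + K q.
  have key : ∀ F, Relation.ReflTransGen step F₀ F → P F ∧ ∃ q s n : ℕ, μ F + q ≤ μ F₀ ∧
      s ≤ n + K * q ∧ Ψ F n ∧ F.V.card ≤ F₀.V.card + C * (q + s) := by
    intro F hF
    induction hF with
    | refl => exact ⟨hP, 0, 0, 0, by simp, by simp, hΨ, by simp⟩
    | tail _ hs ih =>
      obtain ⟨hPF, q, s, n, h1, h2, h3, h4⟩ := ih
      obtain ⟨hPF', hcase⟩ := hstep _ _ hPF hs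
      refine ⟨hPF', ?_⟩
      rcases hcase with rfl | ⟨hV, ⟨hw, hn⟩ | ⟨hw, hn⟩⟩
      · exact ⟨q, s, n, h1, h2, h3, h4⟩
      · refine ⟨q + 1, s, n - K, ?_, ?_, hn n h3, ?_⟩
        · have := hμlt _ _ hw
          push_cast; omega
        · have : K * (q + 1) = K * q + K := by ring
          omega
        · have : C * (q + 1 + s) = C * (q + s) + C := by ring
          omega
      · refine ⟨q, s + 1, n + 1, ?_, by omega, hn n h3, ?_⟩
        · have := hμle _ _ hw
          omega
        · have : C * (q + (s + 1)) = C * (q + s) + C := by ring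
          omega
  set Q : ℕ := (μ F₀ + ⌈N * b⌉).toNat with hQ
  refine ⟨F₀.V.card + C * (Q + K * Q), fun F hF hend => ?_⟩
  obtain ⟨hPF, q, s, n, h1, h2, h3, h4⟩ := key F hF
  obtain ⟨hb, hzero⟩ := hend hPF
  obtain rfl := hzero n h3
  have hlow : -⌈N * b⌉ ≤ μ F := by
    have h5 : -(⌈N * b⌉ : ℝ) ≤ μ F := by
      have h6 := Int.le_ceil ((N : ℝ) * b)
      have h7 : (N : ℝ) * -b < N * wt y F := mul_lt_mul_of_pos_left hb hN'
      rw [hμ]; linarith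
    exact_mod_cast h5
  have hq : q ≤ Q := by omega
  have hs : s ≤ K * Q := by
    have := Nat.mul_le_mul_left K hq
    omega
  exact h4.trans (Nat.add_le_add_left (Nat.mul_le_mul_left C (by omega)) _)

/-! ### Auxiliary counts, weights and intersections -/

/-- Among finitely many disjoint sets, at most `|D|` meet `D`. -/
theorem card_filter_inter_nonempty_le {ι : Type*} (s : Finset ι) (I : ι → Finset ℕ)
    (D : Finset ℕ) (h : ∀ i ∈ s, ∀ j ∈ s, i ≠ j → Disjoint (I i) (I j)) :
    (s.filter fun i => (D ∩ I i).Nonempty).card ≤ D.card := by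
  refine (Finset.card_le_card_biUnion (f := fun i => D ∩ I i) ?_ ?_).trans
    (Finset.card_le_card (Finset.biUnion_subset.2 fun i _ => Finset.inter_subset_left))
  · intro i hi j hj hij
    exact (h i (Finset.mem_filter.1 hi).1 j (Finset.mem_filter.1 hj).1 hij).mono
      Finset.inter_subset_right Finset.inter_subset_right
  · exact fun i hi => (Finset.mem_filter.1 hi).2

theorem Tight.eq_of_le {x : ℝ} {T J : KGraph k} (hT : Tight x T) (hJ : Tight x J) (h : T ≤ J) :
    T = J := by
  rcases h.eq_or_lt with h | h
  · exact h
  · obtain ⟨e, he⟩ := nonempty_of_three_le hT.three_le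
    obtain ⟨f, hf, hfe, -⟩ := exists_mem_ne_ne hT.three_le e e
    exact absurd hT.wt_eq (hJ.lt_wt T h ⟨e, he⟩ (succ_le_card (T.edge_card f hf)
      (T.edge_card e he) hfe (T.edge_subset f hf) (T.edge_subset e he))).ne'

theorem wt_union_sub {y : ℝ} (F D : KGraph k) : wt y (F ∪ D) = wt y F + (wt y D - wt y (D ∩ F)) := by
  have h := wt_union_add_wt_inter y F D
  have h2 : F ∩ D = D ∩ F := KGraph.ext (Finset.inter_comm _ _) (Finset.inter_comm _ _)
  rw [h2] at h
  linarith

theorem inter_E_eq_singleton {J G : KGraph k} {e : Finset ℕ} (hJ : e ∈ J.E) (hG : e ∈ G.E)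
    (hV : J.V ∩ G.V = e) : J.E ∩ G.E = {e} := by
  refine Finset.eq_singleton_iff_unique_mem.2 ⟨Finset.mem_inter.2 ⟨hJ, hG⟩, fun f hf => ?_⟩
  obtain ⟨h1, h2⟩ := Finset.mem_inter.1 hf
  refine edge_eq_of_subset h1 hG ?_
  rw [← hV]
  exact Finset.subset_inter (J.edge_subset f h1) (G.edge_subset f h2)

/-! ### The case of equal densities -/

/-- `F` arises from `G` by attaching the copy `J` of `H₁` or `H₂` at the edge `e`. -/
structure AttachedAlt (H₁ H₂ F G J : KGraph k) (e : Finset ℕ) : Prop where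
  mem : e ∈ G.E
  copy : H₂.Iso J ∨ H₁.Iso J
  inter_E : J.E ∩ G.E = {e}
  inter_V : J.V ∩ G.V = e
  eq : F = G ∪ J

theorem isFlowerAlt_iff {H₁ H₂ F J : KGraph k} :
    IsFlowerAlt H₁ H₂ F J ↔ ∃ G e, AttachedAlt H₁ H₂ F G J e :=
  ⟨fun ⟨G, e, h1, h2, h3, h4, h5⟩ => ⟨G, e, h1, h2, h3, h4, h5⟩,
    fun ⟨G, e, h1, h2, h3, h4, h5⟩ => ⟨G, e, h1, h2, h3, h4, h5⟩⟩

theorem tight_of_copy {x : ℝ} {H₁ H₂ J : KGraph k} (h₁ : Tight x H₁) (h₂ : Tight x H₂)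
    (h : H₂.Iso J ∨ H₁.Iso J) : Tight x J :=
  h.elim h₂.iso h₁.iso

namespace AttachedAlt

variable {x : ℝ} {H₁ H₂ F G J : KGraph k} {e : Finset ℕ}

theorem mem_J (h : AttachedAlt H₁ H₂ F G J e) : e ∈ J.E :=
  (Finset.mem_inter.1 (h.inter_E ▸ Finset.mem_singleton_self e)).1

theorem J_le (h : AttachedAlt H₁ H₂ F G J e) : J ≤ F := h.eq ▸ le_union_right G J

theorem G_le (h : AttachedAlt H₁ H₂ F G J e) : G ≤ F := h.eq ▸ le_union_left G J

theorem notMem_G (h : AttachedAlt H₁ H₂ F G J e) {f : Finset ℕ} (hf : f ∈ J.E) (hfe : f ≠ e) :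
    f ∉ G.E := fun hG => hfe (Finset.mem_singleton.1 (h.inter_E ▸ Finset.mem_inter.2 ⟨hf, hG⟩))

/-- The gluing dichotomy puts T inside J or inside G, and a tight `k`-graph contains no other tight
one, even when one is a copy of H₁ and the other of H₂. -/
theorem eq_or_le (hx : 0 < x) (hx1 : x < 1) (h₁ : Tight x H₁) (h₂ : Tight x H₂)
    (h : AttachedAlt H₁ H₂ F G J e) {T : KGraph k} (hT : H₂.Iso T ∨ H₁.Iso T) (hTF : T ≤ F) :
    T = J ∨ T ≤ G := by
  have tT := tight_of_copy h₁ h₂ hT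
  have tJ := tight_of_copy h₁ h₂ h.copy
  have hE : T.E ⊆ G.E ∪ J.E := hTF.2.trans (by rw [h.eq]; rfl)
  rcases tT.E_subset_or hx hx1 tJ h.mem h.mem_J h.inter_V hE with hE | hE
  · exact Or.inr (tT.le_of_E_subset hx hx1 hE)
  · exact Or.inl (tT.eq_of_le tJ (tT.le_of_E_subset hx hx1 hE))

/-- The only copy through f is J, so a closing pair would be J twice, sharing at least three edges.
-/
theorem openEdge (hx : 0 < x) (hx1 : x < 1) (h₁ : Tight x H₁) (h₂ : Tight x H₂)
    (h : AttachedAlt H₁ H₂ F G J e) {f : Finset ℕ} (hf : f ∈ J.E) (hfe : f ≠ e) :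
    OpenEdgeAlt H₁ H₂ F f := by
  rintro ⟨L, R, hL, hR, cL, cR, hLR⟩
  have hfm : f ∈ L.E ∩ R.E := hLR ▸ Finset.mem_singleton_self f
  obtain ⟨hfL, hfR⟩ := Finset.mem_inter.1 hfm
  have hfG := h.notMem_G hf hfe
  obtain rfl := (h.eq_or_le hx hx1 h₁ h₂ (Or.inl cL) hL).resolve_right fun hle => hfG (hle.2 hfL)
  obtain rfl := (h.eq_or_le hx hx1 h₁ h₂ (Or.inr cR) hR).resolve_right fun hle => hfG (hle.2 hfR)
  have h3 := (h₂.iso cL).three_le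
  rw [Finset.inter_self] at hLR
  rw [hLR] at h3
  simp at h3

theorem union (h : AttachedAlt H₁ H₂ F G J e) {D : KGraph k} (hD : D.V ∩ J.V ⊆ e) :
    AttachedAlt H₁ H₂ (F ∪ D) (G ∪ D) J e := by
  have hV : J.V ∩ (G ∪ D).V = e := by
    rw [union_V, Finset.inter_union_distrib_left, h.inter_V, Finset.inter_comm J.V]
    exact Finset.union_eq_left.2 hD
  have hm : e ∈ (G ∪ D).E := Finset.mem_union_left _ h.mem
  exact ⟨hm, h.copy, inter_E_eq_singleton h.mem_J hm hV, hV, by rw [h.eq, union_right_comm']⟩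

/-- Different fully open flowers meet in their roots only. -/
theorem inter_subset (hx : 0 < x) (hx1 : x < 1) (h₁ : Tight x H₁) (h₂ : Tight x H₂)
    (h : AttachedAlt H₁ H₂ F G J e) {T : KGraph k} (hT : H₂.Iso T ∨ H₁.Iso T) (hTF : T ≤ F)
    (hne : T ≠ J) : T.V ∩ J.V ⊆ e := by
  have := (h.eq_or_le hx hx1 h₁ h₂ hT hTF).resolve_left hne
  rw [← h.inter_V, Finset.inter_comm]
  exact Finset.inter_subset_inter_left this.1

end AttachedAlt

/-! ### Equal densities: the potential -/

theorem OpenEdgeAlt.of_le {H₁ H₂ F F' : KGraph k} {f : Finset ℕ} (h : F ≤ F')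
    (hf : OpenEdgeAlt H₁ H₂ F' f) : OpenEdgeAlt H₁ H₂ F f :=
  fun ⟨L, R, hL, hR, r⟩ => hf ⟨L, R, hL.trans h, hR.trans h, r⟩

/-- There is an open edge outside all fully open flowers. -/
def FreeEdge (isOpen inFlower : KGraph k → Finset ℕ → Prop) (F : KGraph k) : Prop :=
  ∃ f ∈ F.E, isOpen F f ∧ ¬ inFlower F f

/-- The potential of the case of equal densities is at least `n`. -/
def PotentialAlt (H₁ H₂ F : KGraph k) (n : ℕ) : Prop :=
  ∃ 𝒥 : Finset (KGraph k), (∀ J ∈ 𝒥, IsFlowerAlt H₁ H₂ F J) ∧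
    (n ≤ 2 * 𝒥.card ∨
      (FreeEdge (OpenEdgeAlt H₁ H₂) (InFlowerAlt H₁ H₂) F ∧ n ≤ 2 * 𝒥.card + 1))

section
variable {x : ℝ} {H₁ H₂ : KGraph k}

theorem PotentialAlt.eq_zero (hx : 0 < x) (hx1 : x < 1) (h₁ : Tight x H₁) (h₂ : Tight x H₂)
    {F : KGraph k} (hF : ¬ ∃ e ∈ F.E, OpenEdgeAlt H₁ H₂ F e) {n : ℕ}
    (hn : PotentialAlt H₁ H₂ F n) : n = 0 := by
  obtain ⟨𝒥, h𝒥, hn⟩ := hn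
  have h0 : 𝒥 = ∅ := by
    refine Finset.eq_empty_of_forall_notMem fun J hJ => ?_
    obtain ⟨G, e, h⟩ := isFlowerAlt_iff.1 (h𝒥 J hJ)
    obtain ⟨f, hf, hfe, -⟩ := exists_mem_ne_ne (tight_of_copy h₁ h₂ h.copy).three_le e e
    exact hF ⟨f, h.J_le.2 hf, h.openEdge hx hx1 h₁ h₂ hf hfe⟩
  rcases hn with hn | ⟨⟨f, hf, ho, -⟩, -⟩
  · simpa [h0] using hn
  · exact absurd ⟨f, hf, ho⟩ hF

/-- Interiors of distinct flowers are disjoint, so D spoils at most C of them, worth 2 each; the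
free edge may be lost too. -/
theorem PotentialAlt.union (hx : 0 < x) (hx1 : x < 1) (h₁ : Tight x H₁) (h₂ : Tight x H₂)
    {F D : KGraph k} {C n : ℕ} (hD : D.V.card ≤ C) (hn : PotentialAlt H₁ H₂ F n) :
    PotentialAlt H₁ H₂ (F ∪ D) (n - (2 * C + 1)) := by
  classical
  obtain ⟨𝒥, h𝒥, hn⟩ := hn
  have hroot : ∀ J : KGraph k, ∃ G e, J ∈ 𝒥 → AttachedAlt H₁ H₂ F G J e := by
    intro J
    by_cases hJ : J ∈ 𝒥
    · obtain ⟨G, e, h⟩ := isFlowerAlt_iff.1 (h𝒥 J hJ)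
      exact ⟨G, e, fun _ => h⟩
    · exact ⟨J, ∅, fun h => absurd h hJ⟩
  choose g root hroot using hroot
  have hle := card_filter_inter_nonempty_le 𝒥 (fun J => J.V \ root J) D.V (by
    intro J hJ J' hJ' hne
    have := (hroot J hJ).inter_subset hx hx1 h₁ h₂ (hroot J' hJ').copy (hroot J' hJ').J_le hne.symm
    refine Finset.disjoint_left.2 fun u hu hu' => ?_
    exact (Finset.mem_sdiff.1 hu).2 (this (Finset.mem_inter.2
      ⟨(Finset.mem_sdiff.1 hu').1, (Finset.mem_sdiff.1 hu).1⟩)))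
  have hcard := Finset.card_filter_add_card_filter_not (s := 𝒥)
    (fun J => (D.V ∩ (J.V \ root J)).Nonempty)
  refine ⟨𝒥.filter fun J => ¬ (D.V ∩ (J.V \ root J)).Nonempty, ?_, Or.inl ?_⟩
  · intro J hJ
    obtain ⟨hJ, hJD⟩ := Finset.mem_filter.1 hJ
    refine isFlowerAlt_iff.2 ⟨_, _, (hroot J hJ).union (D := D) fun u hu => ?_⟩
    by_contra hue
    obtain ⟨hu1, hu2⟩ := Finset.mem_inter.1 hu
    exact hJD ⟨u, Finset.mem_inter.2 ⟨hu1, Finset.mem_sdiff.2 ⟨hu2, hue⟩⟩⟩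
  · rcases hn with hn | ⟨-, hn⟩ <;> omega

/-- Attaching a fully open flower increases the potential. -/
theorem PotentialAlt.attached (hx : 0 < x) (hx1 : x < 1) (h₁ : Tight x H₁) (h₂ : Tight x H₂)
    {F F' T : KGraph k} {e₀ : Finset ℕ} (hatt : AttachedAlt H₁ H₂ F' F T e₀)
    (helig : (∃ e ∈ F.E, OpenEdgeAlt H₁ H₂ F e) →
      OpenEdgeAlt H₁ H₂ F e₀ ∧ (InFlowerAlt H₁ H₂ F e₀ →
        ¬ FreeEdge (OpenEdgeAlt H₁ H₂) (InFlowerAlt H₁ H₂) F))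
    {n : ℕ} (hn : PotentialAlt H₁ H₂ F n) : PotentialAlt H₁ H₂ F' (n + 1) := by
  classical
  obtain ⟨𝒥, h𝒥, hn⟩ := hn
  have hT : IsFlowerAlt H₁ H₂ F' T := isFlowerAlt_iff.2 ⟨_, _, hatt⟩
  have tT := tight_of_copy h₁ h₂ hatt.copy
  have hTF : ¬ T ≤ F := by
    intro hle
    obtain ⟨f, hf, hfe, -⟩ := exists_mem_ne_ne tT.three_le e₀ e₀
    exact hatt.notMem_G hf hfe (hle.2 hf)
  have hTJ : ∀ J, IsFlowerAlt H₁ H₂ F J → T ≠ J := by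
    rintro J hJ rfl
    obtain ⟨G, e, h⟩ := isFlowerAlt_iff.1 hJ
    exact hTF h.J_le
  -- T meets F only in e₀; if e₀ belongs to the base G, the interior of J is untouched.
  have keep : ∀ {J G : KGraph k} {e : Finset ℕ}, AttachedAlt H₁ H₂ F G J e →
      (e₀ ∈ G.E) → IsFlowerAlt H₁ H₂ F' J := by
    intro J G e h he
    rw [hatt.eq]
    refine isFlowerAlt_iff.2 ⟨_, _, h.union (D := T) ?_⟩
    intro u hu
    obtain ⟨hu1, hu2⟩ := Finset.mem_inter.1 hu
    have : u ∈ e₀ := by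
      rw [← hatt.inter_V]; exact Finset.mem_inter.2 ⟨hu1, h.J_le.1 hu2⟩
    rw [← h.inter_V]
    exact Finset.mem_inter.2 ⟨hu2, G.edge_subset _ he this⟩
  have hn' : n ≤ 2 * 𝒥.card + 1 := by rcases hn with hn | ⟨-, hn⟩ <;> omega
  -- If all flowers survive, the new one adds 2, more than the 1 the free edge may have contributed.
  by_cases hall : ∀ J ∈ 𝒥, IsFlowerAlt H₁ H₂ F' J
  · refine ⟨insert T 𝒥, ?_, Or.inl ?_⟩
    · intro J hJ
      rcases Finset.mem_insert.1 hJ with rfl | hJ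
      · exact hT
      · exact hall J hJ
    · rw [Finset.card_insert_of_notMem fun h => hTJ T (h𝒥 T h) rfl]
      omega
  · push Not at hall
    obtain ⟨J, hJ, hJF'⟩ := hall
    obtain ⟨G, e, h⟩ := isFlowerAlt_iff.1 (h𝒥 J hJ)
    have he₀G : e₀ ∉ G.E := fun he => hJF' (keep h he)
    have he₀J : e₀ ∈ J.E := by
      have := hatt.mem
      rw [h.eq] at this
      exact (Finset.mem_union.1 this).resolve_left he₀G
    -- This edge of the spoiled flower J, neither its root nor e₀, will be the free edge of F'.
    obtain ⟨f, hf, hfe, hfe₀⟩ := exists_mem_ne_ne (tight_of_copy h₁ h₂ h.copy).three_le e e₀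
    have hfo := h.openEdge hx hx1 h₁ h₂ hf hfe
    have hfF := h.J_le.2 hf
    have hfT : f ∉ T.E := fun hfT => hatt.notMem_G hfT hfe₀ hfF
    have hnofree := (helig ⟨f, hfF, hfo⟩).2 ⟨J, h𝒥 J hJ, he₀J⟩
    have hn2 : n ≤ 2 * 𝒥.card := by
      rcases hn with hn | ⟨hfree, -⟩
      · exact hn
      · exact absurd hfree hnofree
    have hle : ∀ S : KGraph k, (H₂.Iso S ∨ H₁.Iso S) → S ≤ F' → f ∈ S.E → S ≤ F := by
      intro S hS hSF hfS
      refine (hatt.eq_or_le hx hx1 h₁ h₂ hS hSF).resolve_left ?_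
      rintro rfl
      exact hfT hfS
    refine ⟨insert T (𝒥.erase J), ?_, Or.inr ⟨⟨f, hatt.G_le.2 hfF, ?_, ?_⟩, ?_⟩⟩
    · intro J' hJ'
      rcases Finset.mem_insert.1 hJ' with rfl | hJ'
      · exact hT
      · obtain ⟨hne, hJ'⟩ := Finset.mem_erase.1 hJ'
        obtain ⟨G', e', h'⟩ := isFlowerAlt_iff.1 (h𝒥 J' hJ')
        refine keep h' ?_
        -- J is a copy other than J', hence lies in the base of J', and with it e₀: only J can be
        -- spoiled.
        exact ((h'.eq_or_le hx hx1 h₁ h₂ h.copy h.J_le).resolve_left hne.symm).2 he₀J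
    · rintro ⟨L, R, hL, hR, cL, cR, hLR⟩
      obtain ⟨hfL, hfR⟩ := Finset.mem_inter.1 (hLR ▸ Finset.mem_singleton_self f : f ∈ L.E ∩ R.E)
      exact hfo ⟨L, R, hle L (Or.inl cL) hL hfL, hle R (Or.inr cR) hR hfR, cL, cR, hLR⟩
    · rintro ⟨J', hJ', hfJ'⟩
      obtain ⟨G', e', h'⟩ := isFlowerAlt_iff.1 hJ'
      -- A flower of F' through f would be a copy already in F, hence J itself, which is no longer a
      -- flower.
      rcases h.eq_or_le hx hx1 h₁ h₂ h'.copy (hle J' h'.copy h'.J_le hfJ') with rfl | hG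
      · exact hJF' hJ'
      · exact h.notMem_G hf hfe (hG.2 hfJ')
    · rw [Finset.card_insert_of_notMem
        fun hm => hTJ T (h𝒥 T (Finset.mem_of_mem_erase hm)) rfl, Finset.card_erase_of_mem hJ]
      have := Finset.card_pos.2 ⟨J, hJ⟩
      omega

/-! ### Equal densities: the weight and the bound on the order -/

/-- `Close-e-Alt` lowers the weight unless it attaches a fully open flower. -/
theorem CloseEAlt.wt_lt_or_attached (h₁ : Tight x H₁)
    (h₂ : Tight x H₂) {F F' : KGraph k} {e : Finset ℕ} (h : CloseEAlt H₁ H₂ F e F') :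
    ∃ T : KGraph k, (H₂.Iso T ∨ H₁.Iso T) ∧ F' = F ∪ T ∧
      (wt x F' < wt x F ∨ (wt x F' = wt x F ∧ AttachedAlt H₁ H₂ F' F T e)) := by
  have key : ∀ T : KGraph k, (H₂.Iso T ∨ H₁.Iso T) → e ∈ T.E → e ∈ F.E → ¬ T ≤ F →
      (wt x (F ∪ T) < wt x F ∨ (wt x (F ∪ T) = wt x F ∧ AttachedAlt H₁ H₂ (F ∪ T) F T e)) := by
    intro T hT heT heF hTF
    have tT := tight_of_copy h₁ h₂ hT
    have heI : e ∈ (T ∩ F).E := Finset.mem_inter.2 ⟨heT, heF⟩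
    have hlt : T ∩ F < T := lt_of_le_of_ne (inter_le_left T F) fun h =>
      hTF (h ▸ inter_le_right T F)
    -- The change is k − x − wt(T ∩ F), which vanishes only if T ∩ F is the single edge e.
    rw [wt_union_sub, tT.wt_eq]
    by_cases hV : T.V ∩ F.V = e
    · have hE := inter_E_eq_singleton heT heF hV
      refine Or.inr ⟨?_, heF, hT, hE, hV, rfl⟩
      have : wt x (T ∩ F) = k - x := by
        rw [wt, inter_E, inter_V, hE, hV, T.edge_card e heT]; simp
      linarith
    · left
      have hsub : e ⊆ (T ∩ F).V := (T ∩ F).edge_subset e heI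
      have hcard : k + 1 ≤ (T ∩ F).V.card := by
        have := Finset.card_lt_card (hsub.ssubset_of_ne fun h => hV h.symm)
        rw [T.edge_card e heT] at this
        exact this
      have := tT.lt_wt _ hlt ⟨e, heI⟩ hcard
      linarith
  obtain ⟨L, R, cL, cR, hLR, hcase⟩ := h
  obtain ⟨heL, heR⟩ := Finset.mem_inter.1 (hLR ▸ Finset.mem_singleton_self e : e ∈ L.E ∩ R.E)
  rcases hcase with ⟨hR, hL, rfl⟩ | ⟨hL, hR, rfl⟩
  · exact ⟨L, Or.inl cL, rfl, key L (Or.inl cL) heL (hR.2 heR) hL⟩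
  · exact ⟨R, Or.inr cR, rfl, key R (Or.inr cR) heR (hL.2 heL) hR⟩

theorem exists_card_le_growOutputAlt (hx : 0 < x) (hx1 : x < 1) (h₁ : Tight x H₁)
    (h₂ : Tight x H₂) {N : ℕ} {p : ℤ} (hN : 0 < N) (hp : (N : ℝ) * x = p)
    {ε : ℝ} (hlam : ∀ F, lam H₁ H₂ F = wt x F) (hk : 0 < k) {eligAlt : KGraph k → Finset ℕ}
    (helig : IsEligible (OpenEdgeAlt H₁ H₂) (InFlowerAlt H₁ H₂) eligAlt) :
    ∃ B : ℕ, ∀ F, GrowOutputAlt H₁ H₂ ε eligAlt F → F.V.card ≤ B := by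
  set C := max H₁.V.card H₂.V.card
  obtain ⟨B, hB⟩ := exists_card_le_of_potential (F₀ := H₁) (y := x) (b := gam H₁ H₂ ε)
    -- Nonemptiness is carried along because admissibility bounds the weight only of graphs with a
    -- vertex.
    (step := GrowStepAlt H₁ H₂ ε eligAlt) (P := fun F => F.V.Nonempty)
    (Ψ := PotentialAlt H₁ H₂) (C := C) (K := 2 * C + 1) hN hp
    (by
      obtain ⟨e, he⟩ := nonempty_of_three_le h₁.three_le
      exact Finset.card_pos.1 (hk.trans_le (le_card_V he)))
    ⟨∅, by simp, Or.inl (by simp)⟩ (by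
      intro F F' hF hstep
      obtain ⟨e₀, hclose, hel⟩ : ∃ e₀, CloseEAlt H₁ H₂ F e₀ F' ∧
          ((∃ e ∈ F.E, OpenEdgeAlt H₁ H₂ F e) →
            OpenEdgeAlt H₁ H₂ F e₀ ∧ (InFlowerAlt H₁ H₂ F e₀ →
              ¬ FreeEdge (OpenEdgeAlt H₁ H₂) (InFlowerAlt H₁ H₂) F)) := by
        rcases hstep.2 with ⟨ho, hc⟩ | ⟨ho, e, -, hc⟩
        · exact ⟨_, hc, fun _ => ⟨(helig.mem_open F ho).2,
            fun hin hfree => helig.avoids_flowers F hfree hin⟩⟩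
        · exact ⟨e, hc, fun h => absurd h ho⟩
      obtain ⟨T, hT, rfl, hcase⟩ := hclose.wt_lt_or_attached h₁ h₂
      have hTC : T.V.card ≤ C := by
        rcases hT with hT | hT
        · rw [hT.card_V]; exact le_max_right _ _
        · rw [hT.card_V]; exact le_max_left _ _
      refine ⟨hF.mono Finset.subset_union_left, Or.inr ⟨?_, ?_⟩⟩
      · exact (Finset.card_union_le _ _).trans (Nat.add_le_add_left hTC _)
      · rcases hcase with hlt | ⟨heq, hatt⟩
        · exact Or.inl ⟨hlt, fun n hn => hn.union hx hx1 h₁ h₂ hTC⟩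
        · exact Or.inr ⟨heq.le, fun n hn => hn.attached hx hx1 h₁ h₂ hatt hel⟩)
  refine ⟨B, fun F hF => hB F hF.1 fun hne => ⟨?_, fun n hn => hn.eq_zero hx hx1 h₁ h₂ hF.2.2⟩⟩
  rw [← hlam]
  exact hF.2.1 F le_rfl hne

end

/-! ### The case of different densities: fully open flowers -/

/-- `F` is covered by a centre `L` and pieces `Y i`, each of which meets `L` in the edge `i`
of `L`, and which are disjoint outside `L`. -/
structure IsStar (F L : KGraph k) (Y : Finset ℕ → KGraph k) : Prop where
  mem_E : ∀ f ∈ F.E, f ∈ L.E ∨ ∃ i ∈ L.E, f ∈ (Y i).E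
  inter_V : ∀ i ∈ L.E, (Y i).V ∩ L.V = i
  mem : ∀ i ∈ L.E, i ∈ (Y i).E
  pairwise : ∀ i ∈ L.E, ∀ j ∈ L.E, i ≠ j → (Y i).V ∩ (Y j).V ⊆ L.V

/-- The pair `(H₁, H₂)` is tight, with `m_k(H₂) = 1 / x` and `m_k(H₁, H₂) = 1 / y`. -/
structure TightPair (x y : ℝ) (H₁ H₂ : KGraph k) : Prop where
  y_pos : 0 < y
  y_lt : y < x
  x_lt : x < 1
  left : TightWrt x y H₁
  right : Tight x H₂

theorem TightPair.x_pos {x y : ℝ} {H₁ H₂ : KGraph k} (h : TightPair x y H₁ H₂) : 0 < x :=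
  h.y_pos.trans h.y_lt

/-- In a star, every copy of `H₁` lies in a single piece. -/
theorem IsStar.exists_le {x y : ℝ} {H₁ H₂ F L : KGraph k} {Y : Finset ℕ → KGraph k}
    (hH : TightPair x y H₁ H₂) (h : IsStar F L Y) (hL : H₂.Iso L) {T : KGraph k}
    (hT : H₁.Iso T) (hTF : T ≤ F) : ∃ i ∈ L.E, T ≤ Y i := by
  classical
  by_contra! hno
  have tT := hH.left.iso hT
  have tL := hH.right.iso hL
  have hy := hH.y_pos
  -- The weight that T collects in the piece over i, without the part lying in the centre.
  set t : Finset ℕ → ℝ := fun i =>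
    (((T.V ∩ (Y i).V) \ L.V).card : ℝ) - y * ((T.E ∩ (Y i).E).erase i).card with ht
  have hVsum : ((T.V ∩ L.V).card : ℝ) + ∑ i ∈ L.E, (((T.V ∩ (Y i).V) \ L.V).card : ℝ)
      ≤ T.V.card := by
    have h1 : (L.E.biUnion fun i => (T.V ∩ (Y i).V) \ L.V).card
        = ∑ i ∈ L.E, ((T.V ∩ (Y i).V) \ L.V).card := by
      refine Finset.card_biUnion fun i hi j hj hij => Finset.disjoint_left.2 fun u hu hu' => ?_
      simp only [Finset.mem_sdiff, Finset.mem_inter] at hu hu'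
      exact hu.2 (h.pairwise i hi j hj hij (Finset.mem_inter.2 ⟨hu.1.2, hu'.1.2⟩))
    have h2 : (L.E.biUnion fun i => (T.V ∩ (Y i).V) \ L.V) ⊆ T.V \ L.V :=
      Finset.biUnion_subset.2 fun i _ =>
        Finset.sdiff_subset_sdiff Finset.inter_subset_left subset_rfl
    have h3 := Finset.card_le_card h2
    have h4 := Finset.card_inter_add_card_sdiff T.V L.V
    rw [h1] at h3
    have : (T.V ∩ L.V).card + ∑ i ∈ L.E, ((T.V ∩ (Y i).V) \ L.V).card ≤ T.V.card := by omega
    exact_mod_cast this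
  have hEsum : (T.E.card : ℝ) ≤ (T.E ∩ L.E).card +
      ∑ i ∈ L.E, (((T.E ∩ (Y i).E).erase i).card : ℝ) := by
    have h1 : T.E ⊆ (T.E ∩ L.E) ∪ L.E.biUnion fun i => (T.E ∩ (Y i).E).erase i := by
      intro f hf
      by_cases hfL : f ∈ L.E
      · exact Finset.mem_union_left _ (Finset.mem_inter.2 ⟨hf, hfL⟩)
      · obtain ⟨i, hi, hfi⟩ := (h.mem_E f (hTF.2 hf)).resolve_left hfL
        refine Finset.mem_union_right _ (Finset.mem_biUnion.2 ⟨i, hi, Finset.mem_erase.2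
          ⟨fun he => hfL (he ▸ hi), Finset.mem_inter.2 ⟨hf, hfi⟩⟩⟩)
    have h2 := (Finset.card_le_card h1).trans ((Finset.card_union_le _ _).trans
      (Nat.add_le_add_left Finset.card_biUnion_le _))
    exact_mod_cast h2
  have hwt : ((T.V ∩ L.V).card : ℝ) - y * (T.E ∩ L.E).card + ∑ i ∈ L.E, t i ≤ wt y T := by
    rw [ht, Finset.sum_sub_distrib, ← Finset.mul_sum, wt]
    have := mul_le_mul_of_nonneg_left hEsum hy.le
    linarith
  have hteq : ∀ i ∈ L.E, t i = wt y (T ∩ Y i) - (T.V ∩ i).card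
      + y * (if i ∈ T.E then 1 else 0) := by
    intro i hi
    have h1 : (((T.V ∩ (Y i).V) \ L.V).card : ℝ) = (T.V ∩ (Y i).V).card - (T.V ∩ i).card := by
      have h2 := Finset.card_inter_add_card_sdiff (T.V ∩ (Y i).V) L.V
      rw [Finset.inter_assoc, h.inter_V i hi] at h2
      rw [eq_sub_iff_add_eq, add_comm]
      exact_mod_cast h2
    have h3 : (((T.E ∩ (Y i).E).erase i).card : ℝ)
        = (T.E ∩ (Y i).E).card - (if i ∈ T.E then 1 else 0) := by
      split_ifs with hiT
      · rw [Finset.cast_card_erase_of_mem (Finset.mem_inter.2 ⟨hiT, h.mem i hi⟩)]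
      · rw [Finset.erase_eq_of_notMem fun hh => hiT (Finset.mem_inter.1 hh).1, sub_zero]
    simp only [ht]
    rw [h1, h3, wt, KGraph.inter_V, KGraph.inter_E]
    ring
  have hbig : ∀ i ∈ L.E, k ≤ (T ∩ Y i).V.card →
      k - x - (T.V ∩ i).card + y * (if i ∈ T.E then 1 else 0) < t i := by
    intro i hi hk
    have hlt : T ∩ Y i < T := lt_of_le_of_ne (inter_le_left _ _) fun he =>
      hno i hi (he ▸ inter_le_right T (Y i))
    have := tT.lt_wt _ hlt hk
    rw [hteq i hi]
    linarith
  have hS : ∀ i ∈ L.E.filter (· ⊆ T.V), -x + y * (if i ∈ T.E then 1 else 0) < t i := by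
    intro i hi
    obtain ⟨hi, hiT⟩ := Finset.mem_filter.1 hi
    have h1 := hbig i hi (by
      exact (L.edge_card i hi).ge.trans (Finset.card_le_card
        (Finset.subset_inter hiT ((Y i).edge_subset i (h.mem i hi)))))
    rw [Finset.inter_eq_right.2 hiT, L.edge_card i hi] at h1
    linarith
  -- T misses a vertex of i, so the general bound exceeds 1 − x > 0; with fewer than k vertices
  -- there are no edges to subtract.
  have hS' : ∀ i ∈ L.E.filter (¬ · ⊆ T.V), 0 ≤ t i := by
    intro i hi
    obtain ⟨hi, hiT⟩ := Finset.mem_filter.1 hi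
    by_cases hk : k ≤ (T ∩ Y i).V.card
    · have h1 := hbig i hi hk
      have h2 : (T.V ∩ i).card + 1 ≤ k := by
        exact (Finset.card_lt_card ⟨Finset.inter_subset_right,
          fun h => hiT (h.trans Finset.inter_subset_left)⟩).trans_eq (L.edge_card i hi)
      have h2' : ((T.V ∩ i).card : ℝ) + 1 ≤ k := by exact_mod_cast h2
      have h3 : 0 ≤ y * (if i ∈ T.E then (1 : ℝ) else 0) := by positivity
      have := hH.x_lt
      linarith
    · have h1 : (T.E ∩ (Y i).E) = ∅ := by
        refine Finset.eq_empty_of_forall_notMem fun f hf => hk (le_card_V (F := T ∩ Y i) hf)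
      simp only [ht, h1]
      simp
  have hTLS : T.E ∩ L.E = (L.E.filter (· ⊆ T.V)).filter (· ∈ T.E) := by
    ext f
    simp only [Finset.mem_inter, Finset.mem_filter]
    exact ⟨fun hf => ⟨⟨hf.2, T.edge_subset f hf.1⟩, hf.1⟩, fun hf => ⟨hf.2, hf.1.1⟩⟩
  rw [← Finset.sum_filter_add_sum_filter_not L.E (· ⊆ T.V), tT.wt_eq] at hwt
  -- If no edge of L lies within V(T), then T has no edge in L, and the one piece holding an edge of
  -- T already makes the weight too large.
  rcases (L.E.filter (· ⊆ T.V)).eq_empty_or_nonempty with hS0 | hSne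
  · obtain ⟨f, hf⟩ := nonempty_of_three_le tT.three_le
    have hTL : T.E ∩ L.E = ∅ := by rw [hTLS, hS0]; rfl
    obtain ⟨i, hi, hfi⟩ := (h.mem_E f (hTF.2 hf)).resolve_left fun hfL =>
      Finset.notMem_empty f (hTL ▸ Finset.mem_inter.2 ⟨hf, hfL⟩)
    have hb := hbig i hi (le_card_V (F := T ∩ Y i) (Finset.mem_inter.2 ⟨hf, hfi⟩))
    have hi' : i ∈ L.E.filter (¬ · ⊆ T.V) := Finset.mem_filter.2 ⟨hi, fun hh =>
      Finset.notMem_empty i (hS0 ▸ Finset.mem_filter.2 ⟨hi, hh⟩)⟩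
    have h1 := Finset.single_le_sum hS' hi'
    have h2 : ((T.V ∩ i).card : ℝ) ≤ (T.V ∩ L.V).card := by
      exact_mod_cast Finset.card_le_card (Finset.inter_subset_inter_left (L.edge_subset i hi))
    have h3 : 0 ≤ y * (if i ∈ T.E then (1 : ℝ) else 0) := by positivity
    rw [hTL, hS0] at hwt
    simp only [Finset.card_empty, Finset.sum_empty] at hwt
    push_cast at hwt
    linarith
  -- Each piece over an edge inside V(T) replaces the cost y of that edge by less than x. So wt y T
  -- exceeds the x-weight of a subhypergraph of L, which is at least k − x.
  · have h1 := Finset.sum_lt_sum_of_nonempty hSne hS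
    have h2 := Finset.sum_nonneg hS'
    rw [Finset.sum_add_distrib, ← Finset.mul_sum, Finset.sum_boole, ← hTLS,
      Finset.sum_const, nsmul_eq_mul] at h1
    have h3 := tL.le_wt (L.sub_le (V := T.V ∩ L.V) (Finset.filter_subset (· ⊆ T.V) L.E)
      (fun e he => Finset.subset_inter (Finset.mem_filter.1 he).2
        (L.edge_subset e (Finset.mem_filter.1 he).1)) Finset.inter_subset_right) hSne
    simp only [wt, sub] at h3
    linarith

/-- The flower with centre `L`, root `e` and petals `R i`. -/
def flower (L : KGraph k) (R : Finset ℕ → KGraph k) (e : Finset ℕ) : KGraph k :=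
  L ∪ iUnionOver (L.E.erase e) R

/-- `F` arises from `G` by attaching the fully open flower with centre `L` and petals `R i` at
the edge `e`. -/
structure Attached (H₁ H₂ F G L : KGraph k) (R : Finset ℕ → KGraph k) (e : Finset ℕ) : Prop where
  mem : e ∈ G.E
  isoL : H₂.Iso L
  inter_E : L.E ∩ G.E = {e}
  inter_V : L.V ∩ G.V = e
  petal : ∀ i ∈ L.E.erase e, H₁.Iso (R i) ∧ (R i).E ∩ (L.E ∪ G.E) = {i} ∧
    (R i).V ∩ (L.V ∪ G.V) = i
  pairwise : ∀ i ∈ L.E.erase e, ∀ j ∈ L.E.erase e, i ≠ j → (R i).V ∩ (R j).V = i ∩ j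
  eq : F = G ∪ flower L R e

theorem isFlower_iff {H₁ H₂ F J : KGraph k} :
    IsFlower H₁ H₂ F J ↔ ∃ G L R e, Attached H₁ H₂ F G L R e ∧ J = flower L R e :=
  ⟨fun ⟨G, L, R, e, h1, h2, h3, h4, h5, h6, h7, h8⟩ =>
      ⟨G, L, R, e, ⟨h1, h2, h3, h4, h5, h6, h8.trans (by rw [h7]; rfl)⟩, h7⟩,
    fun ⟨G, L, R, e, ⟨h1, h2, h3, h4, h5, h6, h7⟩, h8⟩ =>
      ⟨G, L, R, e, h1, h2, h3, h4, h5, h6, h8, h8 ▸ h7⟩⟩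

/-- Every edge lies in a copy of `H₁`. -/
def CoveredBy (H₁ F : KGraph k) : Prop := ∀ f ∈ F.E, ∃ T ≤ F, H₁.Iso T ∧ f ∈ T.E

theorem OpenEdge.of_le {H₁ H₂ F F' : KGraph k} {f : Finset ℕ} (h : F ≤ F')
    (hf : OpenEdge H₁ H₂ F' f) : OpenEdge H₁ H₂ F f := by
  rintro ⟨L, ⟨hL, cL, hR⟩, hfL⟩
  refine hf ⟨L, ⟨hL.trans h, cL, fun e he => ?_⟩, hfL⟩
  obtain ⟨R, hRF, r⟩ := hR e he
  exact ⟨R, hRF.trans h, r⟩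

theorem mem_flower_E {L : KGraph k} {R : Finset ℕ → KGraph k} {e f : Finset ℕ} :
    f ∈ (flower L R e).E ↔ f ∈ L.E ∨ ∃ i ∈ L.E.erase e, f ∈ (R i).E := by
  simp only [flower, union_E, iUnionOver_E, Finset.mem_union, Finset.mem_biUnion]

theorem mem_flower_V {L : KGraph k} {R : Finset ℕ → KGraph k} {e : Finset ℕ} {u : ℕ} :
    u ∈ (flower L R e).V ↔ u ∈ L.V ∨ ∃ i ∈ L.E.erase e, u ∈ (R i).V := by
  simp only [flower, union_V, iUnionOver_V, Finset.mem_union, Finset.mem_biUnion]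

theorem petal_le_flower (L : KGraph k) (R : Finset ℕ → KGraph k) {e i : Finset ℕ}
    (hi : i ∈ L.E.erase e) : R i ≤ flower L R e :=
  le_iff.2 ⟨fun _ hu => mem_flower_V.2 (Or.inr ⟨i, hi, hu⟩),
    fun _ hf => mem_flower_E.2 (Or.inr ⟨i, hi, hf⟩)⟩

namespace Attached

variable {x y : ℝ} {H₁ H₂ F G L : KGraph k} {R : Finset ℕ → KGraph k} {e : Finset ℕ}

theorem mem_L (h : Attached H₁ H₂ F G L R e) : e ∈ L.E :=
  (Finset.mem_inter.1 (h.inter_E ▸ Finset.mem_singleton_self e)).1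

theorem G_le (h : Attached H₁ H₂ F G L R e) : G ≤ F := h.eq ▸ le_union_left _ _

theorem flower_le (h : Attached H₁ H₂ F G L R e) : flower L R e ≤ F := h.eq ▸ le_union_right _ _

theorem L_le (h : Attached H₁ H₂ F G L R e) : L ≤ F := (le_union_left _ _).trans h.flower_le

theorem petal_le (h : Attached H₁ H₂ F G L R e) {i : Finset ℕ} (hi : i ∈ L.E.erase e) :
    R i ≤ F := (petal_le_flower L R hi).trans h.flower_le

theorem mem_petal (h : Attached H₁ H₂ F G L R e) {i : Finset ℕ} (hi : i ∈ L.E.erase e) :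
    i ∈ (R i).E :=
  (Finset.mem_inter.1 ((h.petal i hi).2.1 ▸ Finset.mem_singleton_self i)).1

theorem eq_of_mem_petal (h : Attached H₁ H₂ F G L R e) {i f : Finset ℕ} (hi : i ∈ L.E.erase e)
    (hf : f ∈ (R i).E) (hf' : f ∈ L.E ∨ f ∈ G.E) : f = i :=
  Finset.mem_singleton.1 ((h.petal i hi).2.1 ▸
    Finset.mem_inter.2 ⟨hf, Finset.mem_union.2 hf'⟩)

theorem mem_of_mem_petal (h : Attached H₁ H₂ F G L R e) {i : Finset ℕ} {u : ℕ}
    (hi : i ∈ L.E.erase e) (hu : u ∈ (R i).V) (hu' : u ∈ L.V ∨ u ∈ G.V) : u ∈ i := by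
  rw [← (h.petal i hi).2.2]
  exact Finset.mem_inter.2 ⟨hu, Finset.mem_union.2 hu'⟩

theorem eq_e (h : Attached H₁ H₂ F G L R e) {f : Finset ℕ} (hL : f ∈ L.E) (hG : f ∈ G.E) :
    f = e :=
  Finset.mem_singleton.1 (h.inter_E ▸ Finset.mem_inter.2 ⟨hL, hG⟩)

theorem mem_E (h : Attached H₁ H₂ F G L R e) {f : Finset ℕ} (hf : f ∈ F.E) :
    f ∈ G.E ∨ f ∈ L.E ∨ ∃ i ∈ L.E.erase e, f ∈ (R i).E := by
  rw [h.eq] at hf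
  exact (Finset.mem_union.1 hf).imp_right mem_flower_E.1

theorem flower_inter (h : Attached H₁ H₂ F G L R e) : (flower L R e).V ∩ G.V ⊆ e := by
  intro u hu
  obtain ⟨h1, h2⟩ := Finset.mem_inter.1 hu
  rw [← h.inter_V]
  refine Finset.mem_inter.2 ⟨?_, h2⟩
  rcases mem_flower_V.1 h1 with h1 | ⟨i, hi, h1⟩
  · exact h1
  · exact L.edge_subset i (Finset.mem_of_mem_erase hi) (h.mem_of_mem_petal hi h1 (Or.inr h2))

/-- The base G plays the part of the petal at the root. -/
theorem isStar (h : Attached H₁ H₂ F G L R e) : IsStar F L (Function.update R e G) := by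
  have hne : ∀ i ∈ L.E, i ≠ e → i ∈ L.E.erase e ∧ Function.update R e G i = R i :=
    fun i hi hie => ⟨Finset.mem_erase.2 ⟨hie, hi⟩, Function.update_of_ne hie _ _⟩
  have hGi : ∀ i ∈ L.E.erase e, G.V ∩ (R i).V ⊆ L.V := fun i hi u hu =>
    L.edge_subset i (Finset.mem_of_mem_erase hi) (h.mem_of_mem_petal hi
      (Finset.mem_inter.1 hu).2 (Or.inr (Finset.mem_inter.1 hu).1))
  refine ⟨?_, ?_, ?_, ?_⟩
  · intro f hf
    rcases h.mem_E hf with hf | hf | ⟨i, hi, hf⟩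
    · exact Or.inr ⟨e, h.mem_L, by rwa [Function.update_self]⟩
    · exact Or.inl hf
    · refine Or.inr ⟨i, Finset.mem_of_mem_erase hi, ?_⟩
      rwa [Function.update_of_ne (Finset.ne_of_mem_erase hi)]
  · intro i hi
    by_cases hie : i = e
    · subst hie
      rw [Function.update_self, Finset.inter_comm, h.inter_V]
    · obtain ⟨hi', hu⟩ := hne i hi hie
      rw [hu]
      refine Finset.Subset.antisymm (fun u hu => ?_) (Finset.subset_inter
        ((R i).edge_subset i (h.mem_petal hi')) (L.edge_subset i hi))
      exact h.mem_of_mem_petal hi' (Finset.mem_inter.1 hu).1 (Or.inl (Finset.mem_inter.1 hu).2)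
  · intro i hi
    by_cases hie : i = e
    · subst hie
      rw [Function.update_self]; exact h.mem
    · obtain ⟨hi', hu⟩ := hne i hi hie
      rw [hu]; exact h.mem_petal hi'
  · intro i hi j hj hij
    by_cases hie : i = e
    · subst hie
      obtain ⟨hj', hu⟩ := hne j hj (Ne.symm hij)
      rw [Function.update_self, hu]
      exact hGi j hj'
    · obtain ⟨hi', hu⟩ := hne i hi hie
      rw [hu]
      by_cases hje : j = e
      · subst hje
        rw [Function.update_self, Finset.inter_comm]
        exact hGi i hi'
      · obtain ⟨hj', hu'⟩ := hne j hj hje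
        rw [hu', h.pairwise i hi' j hj' hij]
        exact Finset.inter_subset_left.trans (L.edge_subset i hi)

/-- A copy of `H₁` is a petal of a given flower unless it avoids the flower. -/
theorem le_or_eq_petal (hH : TightPair x y H₁ H₂) (h : Attached H₁ H₂ F G L R e) {T : KGraph k}
    (hT : H₁.Iso T) (hTF : T ≤ F) : T ≤ G ∨ ∃ i ∈ L.E.erase e, T = R i := by
  obtain ⟨i, hi, hTi⟩ := h.isStar.exists_le hH h.isoL hT hTF
  by_cases hie : i = e
  · subst hie
    rw [Function.update_self] at hTi
    exact Or.inl hTi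
  · rw [Function.update_of_ne hie] at hTi
    have hi' := Finset.mem_erase.2 ⟨hie, hi⟩
    exact Or.inr ⟨i, hi', eq_of_le_of_iso hTi hT (h.petal i hi').1⟩

/-- Such an f lies neither in G nor in another petal, since a common edge of two petals would be
contained in i. -/
theorem eq_petal (hH : TightPair x y H₁ H₂) (h : Attached H₁ H₂ F G L R e) {T : KGraph k}
    (hT : H₁.Iso T) (hTF : T ≤ F) {i f : Finset ℕ} (hi : i ∈ L.E.erase e) (hf : f ∈ (R i).E)
    (hfi : f ≠ i) (hfT : f ∈ T.E) : T = R i := by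
  rcases h.le_or_eq_petal hH hT hTF with hG | ⟨j, hj, rfl⟩
  · exact absurd (h.eq_of_mem_petal hi hf (Or.inr (hG.2 hfT))) hfi
  · by_cases hij : i = j
    · rw [hij]
    · have hsub : f ⊆ i ∩ j := by
        rw [← h.pairwise i hi j hj hij]
        exact Finset.subset_inter ((R i).edge_subset f hf) ((R j).edge_subset f hfT)
      exact absurd (edge_eq_of_subset hf (h.mem_petal hi)
        (hsub.trans Finset.inter_subset_left)) hfi

/-- The edges of the petals are open. -/
theorem openEdge (hH : TightPair x y H₁ H₂) (h : Attached H₁ H₂ F G L R e) {i f : Finset ℕ}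
    (hi : i ∈ L.E.erase e) (hf : f ∈ (R i).E) (hfi : f ≠ i) : OpenEdge H₁ H₂ F f := by
  rintro ⟨L', ⟨hL'F, hL', hst⟩, hfL'⟩
  obtain ⟨T, hTF, hT, hTL'⟩ := hst f hfL'
  have hfT : f ∈ T.E := (Finset.mem_inter.1 (hTL' ▸ Finset.mem_singleton_self f)).2
  obtain rfl := h.eq_petal hH hT hTF hi hf hfi hfT
  -- Every edge of F through this vertex u lies in the petal `R i`. But L' has a second edge through
  -- u, while it meets the petal in f only.
  obtain ⟨u, huf, hui⟩ := Finset.not_subset.1 fun hs =>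
    hfi (edge_eq_of_subset hf (h.mem_petal hi) hs)
  have huR := (R i).edge_subset f hf huf
  obtain ⟨g, hg, hgf, hug⟩ := (hH.right.iso hL').exists_edge_ne hH.x_pos hH.x_lt
    (L'.edge_subset f hfL' huf) f
  rcases h.mem_E (hL'F.2 hg) with hgG | hgL | ⟨j, hj, hgj⟩
  · exact hui (h.mem_of_mem_petal hi huR (Or.inr (G.edge_subset g hgG hug)))
  · exact hui (h.mem_of_mem_petal hi huR (Or.inl (L.edge_subset g hgL hug)))
  · by_cases hij : i = j
    · subst hij
      exact hgf (Finset.mem_singleton.1 (hTL' ▸ Finset.mem_inter.2 ⟨hg, hgj⟩))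
    · have : u ∈ i ∩ j := by
        rw [← h.pairwise i hi j hj hij]
        exact Finset.mem_inter.2 ⟨huR, (R j).edge_subset g hgj hug⟩
      exact hui (Finset.mem_inter.1 this).1

/-- The edges of the centre are not open. -/
theorem not_openEdge (hH : TightPair x y H₁ H₂) (h : Attached H₁ H₂ F G L R e)
    (hF : CoveredBy H₁ F) {f : Finset ℕ} (hf : f ∈ L.E) : ¬ OpenEdge H₁ H₂ F f := by
  refine not_not.2 ⟨L, ⟨h.L_le, h.isoL, fun i hi => ?_⟩, hf⟩
  by_cases hie : i = e
  · subst hie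
    -- At the root the copy of H₁ comes from the covering; it is no petal, so it lies in G and meets
    -- L only in the root.
    obtain ⟨T, hTF, hT, hiT⟩ := hF i (h.G_le.2 h.mem)
    refine ⟨T, hTF, hT, ?_⟩
    rcases h.le_or_eq_petal hH hT hTF with hG | ⟨j, hj, rfl⟩
    · refine Finset.Subset.antisymm ?_
        (Finset.singleton_subset_iff.2 (Finset.mem_inter.2 ⟨hi, hiT⟩))
      rw [← h.inter_E]
      exact Finset.inter_subset_inter_left hG.2
    · exact absurd (h.eq_of_mem_petal hj hiT (Or.inl hi)).symm (Finset.ne_of_mem_erase hj)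
  · have hi' := Finset.mem_erase.2 ⟨hie, hi⟩
    refine ⟨R i, h.petal_le hi', (h.petal i hi').1, ?_⟩
    exact Finset.eq_singleton_iff_unique_mem.2 ⟨Finset.mem_inter.2 ⟨hi, h.mem_petal hi'⟩,
      fun g hg => h.eq_of_mem_petal hi' (Finset.mem_inter.1 hg).2
        (Or.inl (Finset.mem_inter.1 hg).1)⟩

/-- Open edges other than the root remain open when a fully open flower is attached. -/
theorem openEdge_of_openEdge (hH : TightPair x y H₁ H₂) (h : Attached H₁ H₂ F G L R e)
    {f : Finset ℕ} (hf : f ∈ G.E) (hfe : f ≠ e) (ho : OpenEdge H₁ H₂ G f) :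
    OpenEdge H₁ H₂ F f := by
  rintro ⟨L', hstar, hfL'⟩
  obtain ⟨hL'F, hL', hst⟩ := hstar
  have tL' := hH.right.iso hL'
  -- All edges of L' are closed, whereas petal edges off the centre are open; so L' avoids them.
  have hsub : L'.E ⊆ G.E ∪ L.E := by
    intro z hz
    rcases h.mem_E (hL'F.2 hz) with hzG | hzL | ⟨i, hi, hzi⟩
    · exact Finset.mem_union_left _ hzG
    · exact Finset.mem_union_right _ hzL
    · by_cases hzi' : z = i
      · exact Finset.mem_union_right _ (hzi' ▸ Finset.mem_of_mem_erase hi)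
      · exact absurd ⟨L', ⟨hL'F, hL', hst⟩, hz⟩ (h.openEdge hH hi hzi hzi')
  have hL'G : L'.E ⊆ G.E :=
    (tL'.E_subset_or hH.x_pos hH.x_lt (hH.right.iso h.isoL) h.mem h.mem_L h.inter_V
      hsub).resolve_right fun hs => hfe (h.eq_e (hs hfL') hf)
  refine ho ⟨L', ⟨tL'.le_of_E_subset hH.x_pos hH.x_lt hL'G, hL', fun z hz => ?_⟩, hfL'⟩
  obtain ⟨T, hTF, hT, hTL'⟩ := hst z hz
  have hzT : z ∈ T.E := (Finset.mem_inter.1 (hTL' ▸ Finset.mem_singleton_self z)).2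
  rcases h.le_or_eq_petal hH hT hTF with hG | ⟨i, hi, rfl⟩
  · exact ⟨T, hG, hT, hTL'⟩
  · obtain rfl := h.eq_of_mem_petal hi hzT (Or.inr (hL'G hz))
    exact absurd (h.eq_e (Finset.mem_of_mem_erase hi) (hL'G hz)) (Finset.ne_of_mem_erase hi)

theorem union (h : Attached H₁ H₂ F G L R e) {D : KGraph k}
    (hD : D.V ∩ (flower L R e).V ⊆ e) : Attached H₁ H₂ (F ∪ D) (G ∪ D) L R e := by
  have hm : e ∈ (G ∪ D).E := Finset.mem_union_left _ h.mem
  have hV : L.V ∩ (G ∪ D).V = e := by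
    rw [union_V, Finset.inter_union_distrib_left, h.inter_V]
    refine Finset.union_eq_left.2 fun u hu => hD ?_
    exact Finset.mem_inter.2 ⟨(Finset.mem_inter.1 hu).2,
      mem_flower_V.2 (Or.inl (Finset.mem_inter.1 hu).1)⟩
  have hpV : ∀ i ∈ L.E.erase e, (R i).V ∩ (L.V ∪ (G ∪ D).V) = i := by
    intro i hi
    rw [union_V, ← Finset.union_assoc, Finset.inter_union_distrib_left, (h.petal i hi).2.2]
    refine Finset.union_eq_left.2 fun u hu => ?_
    obtain ⟨hu1, hu2⟩ := Finset.mem_inter.1 hu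
    exact h.mem_of_mem_petal hi hu1 (Or.inr (G.edge_subset e h.mem
      (hD (Finset.mem_inter.2 ⟨hu2, mem_flower_V.2 (Or.inr ⟨i, hi, hu1⟩)⟩))))
  refine ⟨hm, h.isoL, inter_E_eq_singleton h.mem_L hm hV, hV, fun i hi => ⟨(h.petal i hi).1, ?_,
    hpV i hi⟩, h.pairwise, by rw [h.eq, union_right_comm']⟩
  exact inter_E_eq_singleton (G := L ∪ (G ∪ D)) (h.mem_petal hi)
    (Finset.mem_union_left _ (Finset.mem_of_mem_erase hi)) (hpV i hi)

end Attached

/-! ### The case of different densities: the potential -/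

/-- `J` is a fully open flower of `F` with root `e`. -/
def FlowerAt (H₁ H₂ F J : KGraph k) (e : Finset ℕ) : Prop :=
  ∃ G L R, Attached H₁ H₂ F G L R e ∧ J = flower L R e

theorem FlowerAt.isFlower {H₁ H₂ F J : KGraph k} {e : Finset ℕ} (h : FlowerAt H₁ H₂ F J e) :
    IsFlower H₁ H₂ F J := by
  obtain ⟨G, L, R, h, hJ⟩ := h
  exact isFlower_iff.2 ⟨G, L, R, e, h, hJ⟩

theorem FlowerAt.le {H₁ H₂ F J : KGraph k} {e : Finset ℕ} (h : FlowerAt H₁ H₂ F J e) : J ≤ F := by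
  obtain ⟨G, L, R, h, rfl⟩ := h
  exact h.flower_le

/-- A family of fully open flowers of `F` without common interior vertices or open edges. -/
structure IsFlowerFamily (H₁ H₂ F : KGraph k) (𝒥 : Finset (KGraph k))
    (root : KGraph k → Finset ℕ) : Prop where
  flower : ∀ J ∈ 𝒥, FlowerAt H₁ H₂ F J (root J)
  disjoint : ∀ J ∈ 𝒥, ∀ J' ∈ 𝒥, J ≠ J' → Disjoint (J.V \ root J) (J'.V \ root J')
  notMem : ∀ J ∈ 𝒥, ∀ J' ∈ 𝒥, J ≠ J' → ∀ f, OpenEdge H₁ H₂ F f → f ∈ J.E → f ∉ J'.E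

/-- The potential of the case of different densities is at least `n`. -/
def Potential (H₁ H₂ F : KGraph k) (n : ℕ) : Prop :=
  ∃ 𝒥 root, IsFlowerFamily H₁ H₂ F 𝒥 root ∧
    (n ≤ 2 * 𝒥.card ∨
      (FreeEdge (OpenEdge H₁ H₂) (InFlower H₁ H₂) F ∧ n ≤ 2 * 𝒥.card + 1))

section
variable {x y : ℝ} {H₁ H₂ : KGraph k}

theorem Attached.exists_openEdge (hH : TightPair x y H₁ H₂) {F G L : KGraph k}
    {R : Finset ℕ → KGraph k} {e : Finset ℕ} (h : Attached H₁ H₂ F G L R e) :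
    ∃ i ∈ L.E.erase e, ∃ f ∈ (R i).E, f ≠ i ∧ OpenEdge H₁ H₂ F f := by
  obtain ⟨i, hi, hie, -⟩ := exists_mem_ne_ne (hH.right.iso h.isoL).three_le e e
  have hi' := Finset.mem_erase.2 ⟨hie, hi⟩
  obtain ⟨f, hf, hfi, -⟩ := exists_mem_ne_ne (hH.left.iso (h.petal i hi').1).three_le i i
  exact ⟨i, hi', f, hf, hfi, h.openEdge hH hi' hf hfi⟩

theorem IsFlower.exists_openEdge (hH : TightPair x y H₁ H₂) {F J : KGraph k}
    (h : IsFlower H₁ H₂ F J) : ∃ f ∈ F.E, OpenEdge H₁ H₂ F f := by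
  obtain ⟨G, L, R, e, hatt, rfl⟩ := isFlower_iff.1 h
  obtain ⟨i, hi, f, hf, -, ho⟩ := hatt.exists_openEdge hH
  exact ⟨f, (hatt.petal_le hi).2 hf, ho⟩

theorem Potential.eq_zero (hH : TightPair x y H₁ H₂) {F : KGraph k}
    (hF : ¬ ∃ e ∈ F.E, OpenEdge H₁ H₂ F e) {n : ℕ} (hn : Potential H₁ H₂ F n) : n = 0 := by
  obtain ⟨𝒥, root, h𝒥, hn⟩ := hn
  have h0 : 𝒥 = ∅ := Finset.eq_empty_of_forall_notMem fun J hJ =>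
    hF ((h𝒥.flower J hJ).isFlower.exists_openEdge hH)
  rcases hn with hn | ⟨⟨f, hf, ho, -⟩, -⟩
  · simpa [h0] using hn
  · exact absurd ⟨f, hf, ho⟩ hF

theorem Potential.union {F D : KGraph k} {C n : ℕ} (hD : D.V.card ≤ C)
    (hn : Potential H₁ H₂ F n) : Potential H₁ H₂ (F ∪ D) (n - (2 * C + 1)) := by
  classical
  obtain ⟨𝒥, root, h𝒥, hn⟩ := hn
  have hle := card_filter_inter_nonempty_le 𝒥 (fun J => J.V \ root J) D.V h𝒥.disjoint
  have hcard := Finset.card_filter_add_card_filter_not (s := 𝒥)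
    (fun J => (D.V ∩ (J.V \ root J)).Nonempty)
  refine ⟨𝒥.filter fun J => ¬ (D.V ∩ (J.V \ root J)).Nonempty, root, ⟨?_, ?_, ?_⟩, Or.inl ?_⟩
  · intro J hJ
    obtain ⟨hJ, hJD⟩ := Finset.mem_filter.1 hJ
    obtain ⟨G, L, R, h, hJf⟩ := h𝒥.flower J hJ
    refine ⟨_, L, R, h.union (D := D) fun u hu => ?_, hJf⟩
    by_contra hue
    obtain ⟨hu1, hu2⟩ := Finset.mem_inter.1 hu
    exact hJD ⟨u, Finset.mem_inter.2 ⟨hu1, Finset.mem_sdiff.2 ⟨hJf ▸ hu2, hue⟩⟩⟩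
  · exact fun J hJ J' hJ' => h𝒥.disjoint J (Finset.mem_filter.1 hJ).1 J' (Finset.mem_filter.1 hJ').1
  · exact fun J hJ J' hJ' hne f hf => h𝒥.notMem J (Finset.mem_filter.1 hJ).1 J'
      (Finset.mem_filter.1 hJ').1 hne f (hf.of_le (le_union_left F D))
  · rcases hn with hn | ⟨-, hn⟩ <;> omega

variable {F F' L : KGraph k} {R : Finset ℕ → KGraph k} {e₀ : Finset ℕ}

/-- Attaching a fully open flower at an open edge of a fully open flower creates an open edge
outside all fully open flowers. -/
theorem Attached.freeEdge (hH : TightPair x y H₁ H₂) (hatt : Attached H₁ H₂ F' F L R e₀)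
    (hF : CoveredBy H₁ F) (hF' : CoveredBy H₁ F') (ho : OpenEdge H₁ H₂ F e₀)
    (hin : InFlower H₁ H₂ F e₀) : FreeEdge (OpenEdge H₁ H₂) (InFlower H₁ H₂) F' := by
  obtain ⟨J, hJ, he₀⟩ := hin
  obtain ⟨G, L₁, R₁, e, h, rfl⟩ := isFlower_iff.1 hJ
  obtain ⟨i, hi, he₀i⟩ := (mem_flower_E.1 he₀).resolve_left fun hL =>
    h.not_openEdge hH hF hL ho
  have hiL := Finset.mem_of_mem_erase hi
  have hclosed : ∀ j ∈ L₁.E, ¬ OpenEdge H₁ H₂ F' j := fun j hj hj' =>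
    h.not_openEdge hH hF hj (hj'.of_le hatt.G_le)
  have he₀ne : e₀ ≠ i := fun he => h.not_openEdge hH hF (he ▸ hiL) ho
  obtain ⟨f, hf, hfi, hfe₀⟩ := exists_mem_ne_ne (hH.left.iso (h.petal i hi).1).three_le i e₀
  have hfF : f ∈ F.E := (h.petal_le hi).2 hf
  have hfo' := hatt.openEdge_of_openEdge hH hfF hfe₀ (h.openEdge hH hi hf hfi)
  refine ⟨f, hatt.G_le.2 hfF, hfo', ?_⟩
  rintro ⟨J, hJ, hfJ⟩
  obtain ⟨G₂, L₂, R₂, e₂, h₂, rfl⟩ := isFlower_iff.1 hJ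
  obtain ⟨j, hj, hfj⟩ := (mem_flower_E.1 hfJ).resolve_left fun hL =>
    h₂.not_openEdge hH hF' hL hfo'
  have hRF : R₂ j ≤ F := by
    rcases hatt.le_or_eq_petal hH (h₂.petal j hj).1 (h₂.petal_le hj) with hle | ⟨m, hm, hRm⟩
    · exact hle
    · rw [hRm] at hfj
      have hfm := hatt.eq_of_mem_petal hm hfj (Or.inr hfF)
      exact absurd (hatt.eq_e (hfm ▸ Finset.mem_of_mem_erase hm) hfF) hfe₀
  have hRR := h.eq_petal hH (h₂.petal j hj).1 hRF hi hf hfi hfj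
  -- The petal of the supposed flower through f is the old petal `R₁ i`, so all its edges but one
  -- would be open in F'. Yet i and e₀ are both closed, each lying in the centre of a flower.
  have hopen : ∀ g ∈ (R₁ i).E, g ≠ j → OpenEdge H₁ H₂ F' g := fun g hg hgj =>
    h₂.openEdge hH hj (hRR ▸ hg) hgj
  by_cases hje : j = e₀
  · exact hclosed i hiL (hopen i (h.mem_petal hi) fun hij => he₀ne (hij.trans hje).symm)
  · exact hatt.not_openEdge hH hF' hatt.mem_L (hopen e₀ he₀i fun hh => hje hh.symm)

/-- Attaching a fully open flower increases the potential. -/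
theorem Potential.attached (hH : TightPair x y H₁ H₂) (hatt : Attached H₁ H₂ F' F L R e₀)
    (hF : CoveredBy H₁ F) (hF' : CoveredBy H₁ F')
    (helig : (∃ e ∈ F.E, OpenEdge H₁ H₂ F e) → OpenEdge H₁ H₂ F e₀ ∧ (InFlower H₁ H₂ F e₀ →
      ¬ FreeEdge (OpenEdge H₁ H₂) (InFlower H₁ H₂) F))
    {n : ℕ} (hn : Potential H₁ H₂ F n) : Potential H₁ H₂ F' (n + 1) := by
  classical
  obtain ⟨𝒥, root, h𝒥, hn⟩ := hn
  set J₀ := flower L R e₀ with hJ₀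
  have hJ₀F : ∀ f ∈ J₀.E, f ∈ F.E → f = e₀ := fun f hf hfF =>
    edge_eq_of_subset hf hatt.mem ((Finset.subset_inter (J₀.edge_subset f hf)
      (F.edge_subset f hfF)).trans hatt.flower_inter)
  have hnot : ¬ J₀ ≤ F := by
    intro hle
    obtain ⟨f, hf, hfe, -⟩ := exists_mem_ne_ne (hH.right.iso hatt.isoL).three_le e₀ e₀
    have hfJ : f ∈ J₀.E := mem_flower_E.2 (Or.inl hf)
    exact hfe (hJ₀F f hfJ (hle.2 hfJ))
  have hne : ∀ J ∈ 𝒥, J ≠ J₀ := fun J hJ h => hnot (h ▸ (h𝒥.flower J hJ).le)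
  -- The flowers avoiding e₀ survive, for then e₀ lies in their bases.
  set 𝒦 := 𝒥.filter fun J => e₀ ∉ J.E with h𝒦
  have hsub : ∀ J ∈ 𝒦, J ∈ 𝒥 ∧ e₀ ∉ J.E := fun J hJ => Finset.mem_filter.1 hJ
  set root' : KGraph k → Finset ℕ := fun J => if J = J₀ then e₀ else root J with hroot'
  have hr₀ : root' J₀ = e₀ := if_pos rfl
  have hr : ∀ J ∈ 𝒦, root' J = root J := fun J hJ => if_neg (hne J (hsub J hJ).1)
  have hdis : ∀ J ∈ 𝒦, Disjoint (J.V \ root' J) (J₀.V \ root' J₀) := by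
    intro J hJ
    rw [hr₀]
    refine Finset.disjoint_left.2 fun u hu hu' => ?_
    exact (Finset.mem_sdiff.1 hu').2 (hatt.flower_inter (Finset.mem_inter.2
      ⟨(Finset.mem_sdiff.1 hu').1, (h𝒥.flower J (hsub J hJ).1).le.1 (Finset.mem_sdiff.1 hu).1⟩))
  have hfam : IsFlowerFamily H₁ H₂ F' (insert J₀ 𝒦) root' := by
    refine ⟨?_, ?_, ?_⟩
    · intro J hJ
      rcases Finset.mem_insert.1 hJ with rfl | hJ
      · rw [hr₀]; exact ⟨F, L, R, hatt, rfl⟩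
      · rw [hr J hJ]
        obtain ⟨G, L₁, R₁, h, hJf⟩ := h𝒥.flower J (hsub J hJ).1
        refine ⟨G ∪ J₀, L₁, R₁, ?_, hJf⟩
        rw [hatt.eq]
        refine h.union fun u hu => ?_
        obtain ⟨hu1, hu2⟩ := Finset.mem_inter.1 hu
        refine h.flower_inter (Finset.mem_inter.2 ⟨hu2, ?_⟩)
        have he₀G : e₀ ∈ G.E := by
          have hm := hatt.mem
          rw [h.eq, ← hJf] at hm
          exact (Finset.mem_union.1 hm).resolve_right (hsub J hJ).2
        exact G.edge_subset e₀ he₀G (hatt.flower_inter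
          (Finset.mem_inter.2 ⟨hu1, h.flower_le.1 hu2⟩))
    · intro J hJ J' hJ' hJJ'
      rcases Finset.mem_insert.1 hJ with rfl | hJ <;> rcases Finset.mem_insert.1 hJ' with rfl | hJ'
      · exact absurd rfl hJJ'
      · exact (hdis J' hJ').symm
      · exact hdis J hJ
      · rw [hr J hJ, hr J' hJ']
        exact h𝒥.disjoint J (hsub J hJ).1 J' (hsub J' hJ').1 hJJ'
    · intro J hJ J' hJ' hJJ' f hf hfJ hfJ'
      rcases Finset.mem_insert.1 hJ with rfl | hJ <;> rcases Finset.mem_insert.1 hJ' with rfl | hJ'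
      · exact absurd rfl hJJ'
      · exact (hsub J' hJ').2
          (hJ₀F f hfJ ((h𝒥.flower J' (hsub J' hJ').1).le.2 hfJ') ▸ hfJ')
      · exact (hsub J hJ).2 (hJ₀F f hfJ' ((h𝒥.flower J (hsub J hJ).1).le.2 hfJ) ▸ hfJ)
      · exact h𝒥.notMem J (hsub J hJ).1 J' (hsub J' hJ').1 hJJ' f (hf.of_le hatt.G_le) hfJ hfJ'
  have hcardins : (insert J₀ 𝒦).card = 𝒦.card + 1 :=
    Finset.card_insert_of_notMem fun h => hne J₀ (hsub J₀ h).1 rfl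
  refine ⟨insert J₀ 𝒦, root', hfam, ?_⟩
  rw [hcardins]
  by_cases hin : InFlower H₁ H₂ F e₀
  · obtain ⟨J, hJ, -⟩ := id hin
    obtain ⟨ho, hnofree⟩ := helig (hJ.exists_openEdge hH)
    have hn : n ≤ 2 * 𝒥.card := hn.resolve_right fun h => hnofree hin h.1
    -- Members of the family share no open edge, so at most one is discarded.
    have h1 : (𝒥.filter fun J => e₀ ∈ J.E).card ≤ 1 := by
      refine Finset.card_le_one.2 fun J hJ J' hJ' => ?_
      obtain ⟨hJ, he⟩ := Finset.mem_filter.1 hJ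
      obtain ⟨hJ', he'⟩ := Finset.mem_filter.1 hJ'
      by_contra hJJ'
      exact h𝒥.notMem J hJ J' hJ' hJJ' e₀ ho he he'
    have h2 := Finset.card_filter_add_card_filter_not (s := 𝒥) (fun J => e₀ ∈ J.E)
    rw [← h𝒦] at h2
    exact Or.inr ⟨hatt.freeEdge hH hF hF' ho hin, by omega⟩
  · have h1 : 𝒦 = 𝒥 := Finset.filter_true_of_mem fun J hJ he =>
      hin ⟨J, (h𝒥.flower J hJ).isFlower, he⟩
    rw [h1]
    left
    rcases hn with hn | ⟨-, hn⟩ <;> omega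

end

/-! ### The case of different densities: the weight -/

theorem wt_union_sdiff {a : ℝ} (F D : KGraph k) :
    wt a (F ∪ D) = wt a F + ((D.V \ F.V).card - a * (D.E \ F.E).card) := by
  have h1 : ((F.V ∪ D.V).card : ℝ) = F.V.card + (D.V \ F.V).card := by
    rw [Finset.union_comm, ← Finset.sdiff_union_self_eq_union,
      Finset.card_union_of_disjoint Finset.sdiff_disjoint]
    push_cast; ring
  have h2 : ((F.E ∪ D.E).card : ℝ) = F.E.card + (D.E \ F.E).card := by
    rw [Finset.union_comm, ← Finset.sdiff_union_self_eq_union,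
      Finset.card_union_of_disjoint Finset.sdiff_disjoint]
    push_cast; ring
  rw [wt, wt, union_V, union_E, h1, h2]
  ring

section
variable {x y : ℝ} {H₁ H₂ : KGraph k}

/-- Attaching copies `R i` of `H₁` at edges `i` of `L` to a graph `B` with `L ≤ B` changes the
weight by at most as much as if there were no further intersections, and by less if there are. -/
theorem petals_bound (hH : TightPair x y H₁ H₂) {L B : KGraph k} (hL : Tight x L) (hLB : L ≤ B)
    {R : Finset ℕ → KGraph k} (A : Finset (Finset ℕ)) (hA : A ⊆ L.E)
    (hR : ∀ i ∈ A, H₁.Iso (R i)) (hRB : ∀ i ∈ A, (R i).E ∩ B.E = {i}) :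
    (((iUnionOver A R).V \ B.V).card : ℝ) - y * ((iUnionOver A R).E \ B.E).card
        ≤ A.card * (y - x) ∧
      ((((iUnionOver A R).V \ B.V).card : ℝ) - y * ((iUnionOver A R).E \ B.E).card
          = A.card * (y - x) →
        ∀ i ∈ A, (R i).V ∩ B.V = i ∧ ∀ j ∈ A, i ≠ j → (R i).V ∩ (R j).V ⊆ B.V) := by
  classical
  induction A using Finset.strongInduction with
  | H A ih =>
  rcases A.eq_empty_or_nonempty with rfl | ⟨a, ha⟩
  · simp
  have hmem : ∀ i ∈ A, i ∈ (R i).E := fun i hi =>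
    (Finset.mem_inter.1 (hRB i hi ▸ Finset.mem_singleton_self i)).1
  have huniq : ∀ i ∈ A, ∀ f ∈ (R i).E, f ∈ B.E → f = i := fun i hi f hf hfB =>
    Finset.mem_singleton.1 (hRB i hi ▸ Finset.mem_inter.2 ⟨hf, hfB⟩)
  have htight : ∀ i ∈ A, TightWrt x y (R i) := fun i hi => hH.left.iso (hR i hi)
  -- Petals may share edges, which saves edges but also vertices. A largest light cluster D is split
  -- off; singletons qualify, so one exists.
  set 𝒟 := A.powerset.filter fun D => D.Nonempty ∧ wt y (iUnionOver D R) ≤ k - x ∧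
    (2 ≤ D.card → wt y (iUnionOver D R) < k - x) with h𝒟
  have h𝒟ne : 𝒟.Nonempty := by
    refine ⟨{a}, Finset.mem_filter.2 ⟨by simpa using ha, by simp, ?_, by simp⟩⟩
    have : iUnionOver {a} R = R a := KGraph.ext (by simp) (by simp)
    rw [this]
    exact (htight a ha).wt_eq.le
  obtain ⟨D, hD, hmax⟩ := Finset.exists_max_image 𝒟 Finset.card h𝒟ne
  obtain ⟨hDA, hDne, hDwt, hDlt⟩ := Finset.mem_filter.1 hD
  rw [Finset.mem_powerset] at hDA
  set U := iUnionOver D R with hU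
  set W := iUnionOver (A \ D) R with hW
  have hsplit : iUnionOver A R = U ∪ W := by
    refine KGraph.ext ?_ ?_
    · change A.biUnion _ = D.biUnion _ ∪ (A \ D).biUnion _
      rw [← Finset.union_biUnion, Finset.union_sdiff_of_subset hDA]
    · change A.biUnion _ = D.biUnion _ ∪ (A \ D).biUnion _
      rw [← Finset.union_biUnion, Finset.union_sdiff_of_subset hDA]
  have hUmem : ∀ f ∈ U.E, ∃ i ∈ D, f ∈ (R i).E := fun f hf => Finset.mem_biUnion.1 hf
  have hUB : U.E ∩ B.E = D := by
    ext f
    refine ⟨fun hf => ?_, fun hf => ?_⟩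
    · obtain ⟨hfU, hfB⟩ := Finset.mem_inter.1 hf
      obtain ⟨i, hi, hfi⟩ := hUmem f hfU
      rw [huniq i (hDA hi) f hfi hfB]; exact hi
    · exact Finset.mem_inter.2 ⟨Finset.mem_biUnion.2 ⟨f, hf, hmem f (hDA hf)⟩,
        hLB.2 (hA (hDA hf))⟩
  -- A petal sharing an edge with U could be added to D with a further drop of weight, against
  -- maximality.
  have hEdisj : ∀ j ∈ A \ D, ∀ f ∈ (R j).E, f ∉ U.E := by
    intro j hj f hfj hfU
    obtain ⟨hjA, hjD⟩ := Finset.mem_sdiff.1 hj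
    have hlt : R j ∩ U < R j := lt_of_le_of_notMem_E (inter_le_left _ _) (hmem j hjA) fun h =>
      hjD (hUB ▸ Finset.mem_inter.2 ⟨(Finset.mem_inter.1 h).2, hLB.2 (hA hjA)⟩)
    have h1 := (htight j hjA).lt_wt _ hlt
      (le_card_V (F := R j ∩ U) (Finset.mem_inter.2 ⟨hfj, hfU⟩))
    have h2 : iUnionOver (insert j D) R = U ∪ R j := by
      refine KGraph.ext ?_ ?_
      · change (insert j D).biUnion _ = D.biUnion _ ∪ _
        rw [Finset.biUnion_insert, Finset.union_comm]
      · change (insert j D).biUnion _ = D.biUnion _ ∪ _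
        rw [Finset.biUnion_insert, Finset.union_comm]
    have h3 : wt y (iUnionOver (insert j D) R) < k - x := by
      rw [h2, wt_union_sub, (htight j hjA).wt_eq]
      linarith
    have h4 := hmax (insert j D) (Finset.mem_filter.2 ⟨Finset.mem_powerset.2
      (Finset.insert_subset hjA hDA), Finset.insert_nonempty _ _, h3.le, fun _ => h3⟩)
    rw [Finset.card_insert_of_notMem hjD] at h4
    omega
  have hE : (((U ∪ W).E \ B.E).card : ℝ) = (U.E \ B.E).card + (W.E \ B.E).card := by
    rw [union_E, Finset.union_sdiff_distrib, Finset.card_union_of_disjoint]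
    · push_cast; rfl
    · refine Finset.disjoint_left.2 fun f hf hf' => ?_
      obtain ⟨j, hj, hfj⟩ := Finset.mem_biUnion.1 (Finset.mem_sdiff.1 hf').1
      exact hEdisj j hj f hfj (Finset.mem_sdiff.1 hf).1
  have hVu : (U ∪ W).V \ B.V = (U.V \ B.V) ∪ (W.V \ B.V) := by
    rw [union_V, Finset.union_sdiff_distrib]
  have hV : (((U ∪ W).V \ B.V).card : ℝ) ≤ (U.V \ B.V).card + (W.V \ B.V).card := by
    rw [hVu]; exact_mod_cast Finset.card_union_le _ _
  have hUV : ((U.V \ B.V).card : ℝ) + (U.V ∩ B.V).card = U.V.card := by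
    exact_mod_cast Finset.card_sdiff_add_card_inter U.V B.V
  have hUE : ((U.E \ B.E).card : ℝ) + D.card = U.E.card := by
    rw [← hUB]
    exact_mod_cast Finset.card_sdiff_add_card_inter U.E B.E
  -- U covers the edges D of L, and tightness of L says how many vertices these span. Hence U
  -- contributes at most |D|(y − x).
  have hDB : k - x + x * D.card ≤ (U.V ∩ B.V).card := by
    have h1 := hL.le_wt (L.sub_le (V := U.V ∩ L.V) (hDA.trans hA) (fun i hi =>
      Finset.subset_inter (U.edge_subset i (Finset.mem_inter.1 (hUB.symm ▸ hi)).1)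
        (L.edge_subset i (hA (hDA hi)))) Finset.inter_subset_right) hDne
    have h2 : ((U.V ∩ L.V).card : ℝ) ≤ (U.V ∩ B.V).card := by
      exact_mod_cast Finset.card_le_card (Finset.inter_subset_inter_left hLB.1)
    simp only [wt, sub] at h1
    linarith
  have hWih := ih (A \ D) (Finset.sdiff_ssubset hDA hDne) (Finset.sdiff_subset.trans hA)
    (fun i hi => hR i (Finset.mem_sdiff.1 hi).1) (fun i hi => hRB i (Finset.mem_sdiff.1 hi).1)
  rw [← hW] at hWih
  obtain ⟨hW1, hW2⟩ := hWih
  have hcard : ((A \ D).card : ℝ) = A.card - D.card := by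
    rw [Finset.cast_card_sdiff hDA]
  have hUwt : wt y U = U.V.card - y * U.E.card := rfl
  have hUbound : ((U.V \ B.V).card : ℝ) - y * (U.E \ B.E).card
      = wt y U - (U.V ∩ B.V).card + y * D.card := by
    rw [hUwt, ← hUV, ← hUE]; ring
  rw [hsplit, hE]
  rw [hcard] at hW1 hW2
  refine ⟨by linarith, fun heq => ?_⟩
  -- Equality excludes clusters of two or more petals, which are strictly light, and any vertex
  -- shared outside B.
  have hD1 : D.card = 1 := by
    have h1 := Finset.card_pos.2 hDne
    by_contra hne
    have := hDlt (by omega)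
    linarith
  obtain ⟨i, rfl⟩ := Finset.card_eq_one.1 hD1
  have hWall := hW2 (by linarith)
  have hVeq : (((U ∪ W).V \ B.V).card : ℝ) = (U.V \ B.V).card + (W.V \ B.V).card := by linarith
  have hdisj : Disjoint (U.V \ B.V) (W.V \ B.V) := by
    rw [← Finset.card_union_eq_card_add_card, ← hVu]
    exact_mod_cast hVeq
  have hiA : i ∈ A := hDA (Finset.mem_singleton_self i)
  have hUi : U = R i := KGraph.ext (by simp [hU]) (by simp [hU])
  have hRi : (R i).V ∩ B.V = i := by
    have h1 : ((U.V ∩ B.V).card : ℝ) = k := by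
      rw [Finset.card_singleton] at hDB hUbound hW1
      push_cast at hDB hUbound hW1
      linarith
    have h2 : (U.V ∩ B.V).card = k := by exact_mod_cast h1
    rw [hUi] at h2
    exact (Finset.eq_of_subset_of_card_le (Finset.subset_inter ((R i).edge_subset i (hmem i hiA))
      (B.edge_subset i (hLB.2 (hA hiA)))) (by rw [h2, L.edge_card i (hA hiA)])).symm
  have hcross : ∀ j ∈ A \ {i}, (R i).V ∩ (R j).V ⊆ B.V := by
    intro j hj u hu
    by_contra huB
    obtain ⟨hu1, hu2⟩ := Finset.mem_inter.1 hu
    exact Finset.disjoint_left.1 hdisj (Finset.mem_sdiff.2 ⟨hUi ▸ hu1, huB⟩)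
      (Finset.mem_sdiff.2 ⟨Finset.mem_biUnion.2 ⟨j, hj, hu2⟩, huB⟩)
  intro a ha
  by_cases hai : a = i
  · subst hai
    exact ⟨hRi, fun j hj hne => hcross j (Finset.mem_sdiff.2
      ⟨hj, fun h => hne (Finset.mem_singleton.1 h).symm⟩)⟩
  · have haD : a ∈ A \ {i} := Finset.mem_sdiff.2 ⟨ha, by simpa using hai⟩
    refine ⟨(hWall a haD).1, fun j hj hne => ?_⟩
    by_cases hji : j = i
    · subst hji
      rw [Finset.inter_comm]; exact hcross a haD
    · exact (hWall a haD).2 j (Finset.mem_sdiff.2 ⟨hj, by simpa using hji⟩) hne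

/-- `F'` is the union of `F` and a `k`-graph on at most `C` vertices, and every edge of `F'` lies
in a copy of `H₁` if this holds for `F`. -/
def Extends (C : ℕ) (H₁ F F' : KGraph k) : Prop :=
  (∃ D : KGraph k, F' = F ∪ D ∧ D.V.card ≤ C) ∧ (CoveredBy H₁ F → CoveredBy H₁ F')

/-- R ∩ F is a proper part of R with at least k vertices, so it weighs more than R: this step is
always degenerate. -/
theorem AttachH₁.wt_lt (hH : TightPair x y H₁ H₂) {F F' : KGraph k} (h : AttachH₁ H₁ F F') :
    Extends H₁.V.card H₁ F F' ∧ wt y F' < wt y F := by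
  obtain ⟨S, hSF, hS, R, hR, hSR, hRF, rfl⟩ := h
  have tR := hH.left.iso hR
  refine ⟨⟨⟨R, rfl, hR.card_V.le⟩, fun hF f hf => ?_⟩, ?_⟩
  · rcases Finset.mem_union.1 hf with hf | hf
    · obtain ⟨T, hT, r⟩ := hF f hf
      exact ⟨T, hT.trans (le_union_left _ _), r⟩
    · exact ⟨R, le_union_right _ _, hR, hf⟩
  · have h1 := tR.lt_wt (R ∩ F) (lt_of_le_of_ne (inter_le_left _ _) fun he =>
      hRF (he ▸ inter_le_right R F).2)
      (hS.ge.trans (Finset.card_le_card (Finset.subset_inter hSR hSF)))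
    rw [wt_union_sub, tR.wt_eq]
    linarith

/-- `Close-e` lowers the weight unless it does nothing or attaches a fully open flower. -/
theorem CloseE.trichotomy (hH : TightPair x y H₁ H₂) {F F' : KGraph k} {e : Finset ℕ}
    (he : e ∈ F.E) (h : CloseE H₁ H₂ F e F') :
    Extends (H₂.V.card + H₂.E.card * H₁.V.card) H₁ F F' ∧
      (F' = F ∨ wt y F' < wt y F ∨
        (wt y F' = wt y F ∧ ∃ L R, Attached H₁ H₂ F' F L R e)) := by
  obtain ⟨L, R, hL, heL, -, hR, rfl⟩ := h
  have tL := hH.right.iso hL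
  set A := L.E \ F.E with hA
  set U := iUnionOver A R with hU
  have hAL : A ⊆ L.E := Finset.sdiff_subset
  have hmem : ∀ i ∈ A, i ∈ (R i).E := fun i hi =>
    (Finset.mem_inter.1 ((hR i hi).2.1 ▸ Finset.mem_singleton_self i)).2
  -- A petal with fewer than k vertices in F shares no edge with F.
  have hRB : ∀ i ∈ A, (R i).E ∩ (F ∪ L).E = {i} := by
    intro i hi
    refine Finset.eq_singleton_iff_unique_mem.2 ⟨Finset.mem_inter.2 ⟨hmem i hi,
      Finset.mem_union_right _ (hAL hi)⟩, fun f hf => ?_⟩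
    obtain ⟨hfR, hf⟩ := Finset.mem_inter.1 hf
    rcases Finset.mem_union.1 hf with hfF | hfL
    · have h1 := (hR i hi).2.2
      have h2 := le_card_V (F := R i ∩ F) (Finset.mem_inter.2 ⟨hfR, hfF⟩)
      rw [inter_V] at h2
      omega
    · exact Finset.mem_singleton.1 ((hR i hi).2.1 ▸ Finset.mem_inter.2 ⟨hfL, hfR⟩)
  refine ⟨⟨⟨L ∪ U, union_assoc' _ _ _, ?_⟩, fun hF f hf => ?_⟩, ?_⟩
  · refine (Finset.card_union_le _ _).trans (Nat.add_le_add hL.card_V.le ?_)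
    refine (Finset.card_biUnion_le_card_mul A _ H₁.V.card
      fun i hi => (hR i hi).1.card_V.le).trans (Nat.mul_le_mul_right _ ?_)
    rw [← hL.card_E]
    exact Finset.card_le_card hAL
  · have hRle : ∀ i ∈ A, R i ≤ F ∪ L ∪ U := fun i hi =>
      le_trans (le_iff.2 ⟨fun u hu => Finset.mem_biUnion.2 ⟨i, hi, hu⟩,
        fun g hg => Finset.mem_biUnion.2 ⟨i, hi, hg⟩⟩ : R i ≤ U) (le_union_right _ _)
    have hFcase : f ∈ F.E → ∃ T ≤ F ∪ L ∪ U, H₁.Iso T ∧ f ∈ T.E := by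
      intro hf
      obtain ⟨T, hT, r⟩ := hF f hf
      exact ⟨T, hT.trans ((le_union_left _ _).trans (le_union_left _ _)), r⟩
    rcases Finset.mem_union.1 hf with hf | hf
    · by_cases hfF : f ∈ F.E
      · exact hFcase hfF
      · have hfA : f ∈ A := Finset.mem_sdiff.2 ⟨(Finset.mem_union.1 hf).resolve_left hfF, hfF⟩
        exact ⟨R f, hRle f hfA, (hR f hfA).1, hmem f hfA⟩
    · obtain ⟨i, hi, hfi⟩ := Finset.mem_biUnion.1 hf
      exact ⟨R i, hRle i hi, (hR i hi).1, hfi⟩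
  rcases A.eq_empty_or_nonempty with hA0 | ⟨a, ha⟩
  · left
    have hLF : L ≤ F := tL.le_of_E_subset hH.x_pos hH.x_lt (Finset.sdiff_eq_empty_iff_subset.1 hA0)
    rw [union_eq_left hLF]
    exact union_eq_left (le_iff.2 (by simp [hU, hA0]))
  right
  obtain ⟨hb1, hb2⟩ := petals_bound hH tL (le_union_right F L) A hAL (fun i hi => (hR i hi).1) hRB
  rw [← hU] at hb1 hb2
  have hlt : L ∩ F < L := lt_of_le_of_notMem_E (inter_le_left _ _) (hAL ha) fun h =>
    (Finset.mem_sdiff.1 ha).2 (Finset.mem_inter.1 h).2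
  have heI : e ∈ (L ∩ F).E := Finset.mem_inter.2 ⟨heL, he⟩
  -- The new edges of L cost y|A|, which the petal bound |A|(y − x) turns into x|A|. What remains is
  -- at most k − x − wt x (L ∩ F) ≤ 0, and equality makes both bounds sharp.
  have h1 : wt y (F ∪ L ∪ U) = wt y F + ((L.V \ F.V).card - y * A.card) +
      ((U.V \ (F ∪ L).V).card - y * (U.E \ (F ∪ L).E).card) := by
    rw [wt_union_sdiff (F ∪ L) U, wt_union_sdiff F L]
  have h2 : ((L.V \ F.V).card : ℝ) - x * A.card = k - x - wt x (L ∩ F) := by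
    have h3 := wt_union_sdiff (a := x) F L
    have h4 := wt_union_sub (y := x) F L
    rw [tL.wt_eq] at h4
    linarith
  have h5 := tL.le_wt (inter_le_left L F) ⟨e, heI⟩
  by_cases heq : wt y (F ∪ L ∪ U) = wt y F
  · right
    refine ⟨heq, L, R, ?_⟩
    have hV : L.V ∩ F.V = e := by
      by_contra hne
      have hcard : k + 1 ≤ (L ∩ F).V.card := by
        have := Finset.card_lt_card (((L ∩ F).edge_subset e heI).ssubset_of_ne
          fun h => hne h.symm)
        rw [L.edge_card e heL] at this
        exact this
      have := tL.lt_wt _ hlt ⟨e, heI⟩ hcard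
      linarith
    have hnice := hb2 (by linarith)
    have hE := inter_E_eq_singleton heL he hV
    have hAe : L.E.erase e = A := by
      rw [hA, ← Finset.sdiff_inter_self_left, hE, Finset.sdiff_singleton_eq_erase]
    refine ⟨he, hL, hE, hV, ?_, ?_, ?_⟩
    · rw [hAe]
      intro i hi
      refine ⟨(hR i hi).1, ?_, ?_⟩
      · rw [Finset.union_comm]; exact hRB i hi
      · rw [Finset.union_comm]; exact (hnice i hi).1
    · rw [hAe]
      intro i hi j hj hij
      refine Finset.Subset.antisymm (fun u hu => ?_) (Finset.inter_subset_inter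
        ((R i).edge_subset i (hmem i hi)) ((R j).edge_subset j (hmem j hj)))
      have huB := (hnice i hi).2 j hj hij hu
      obtain ⟨hu1, hu2⟩ := Finset.mem_inter.1 hu
      have h6 : u ∈ (R i).V ∩ (F ∪ L).V := Finset.mem_inter.2 ⟨hu1, huB⟩
      have h7 : u ∈ (R j).V ∩ (F ∪ L).V := Finset.mem_inter.2 ⟨hu2, huB⟩
      rw [(hnice i hi).1] at h6
      rw [(hnice j hj).1] at h7
      exact Finset.mem_inter.2 ⟨h6, h7⟩
    · rw [flower, hAe, union_assoc']
  · left
    refine lt_of_le_of_ne ?_ heq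
    linarith

theorem exists_card_le_growOutput (hH : TightPair x y H₁ H₂) {N : ℕ} {p : ℤ} (hN : 0 < N)
    (hp : (N : ℝ) * y = p) {ε : ℝ} (hlam : ∀ F, lam H₁ H₂ F = wt y F) (hk : 0 < k)
    {elig : KGraph k → Finset ℕ}
    (helig : IsEligible (OpenEdge H₁ H₂) (InFlower H₁ H₂) elig) :
    ∃ B : ℕ, ∀ F, GrowOutput H₁ H₂ ε elig F → F.V.card ≤ B := by
  set C := max H₁.V.card (H₂.V.card + H₂.E.card * H₁.V.card) with hC
  have hne₁ : H₁.V.Nonempty := by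
    obtain ⟨e, he⟩ := nonempty_of_three_le hH.left.three_le
    exact Finset.card_pos.1 (hk.trans_le (le_card_V he))
  obtain ⟨B, hB⟩ := exists_card_le_of_potential (F₀ := H₁) (y := y) (b := gam H₁ H₂ ε)
    -- The covering by copies of H₁ is needed to close the roots of flowers.
    (step := GrowStep H₁ H₂ ε elig) (P := fun F => F.V.Nonempty ∧ CoveredBy H₁ F)
    (Ψ := Potential H₁ H₂) (C := C) (K := 2 * C + 1) hN hp
    ⟨hne₁, fun f hf => ⟨H₁, le_rfl, Iso.refl H₁, hf⟩⟩
    ⟨∅, fun _ => ∅, ⟨by simp, by simp, by simp⟩, Or.inl (by simp)⟩ (by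
      rintro F F' ⟨hFne, hF⟩ hstep
      obtain ⟨hext, hcase⟩ : Extends C H₁ F F' ∧ (F' = F ∨ wt y F' < wt y F ∨
          (wt y F' = wt y F ∧ ∃ e₀ L R, Attached H₁ H₂ F' F L R e₀ ∧
            ((∃ e ∈ F.E, OpenEdge H₁ H₂ F e) → OpenEdge H₁ H₂ F e₀ ∧ (InFlower H₁ H₂ F e₀ →
              ¬ FreeEdge (OpenEdge H₁ H₂) (InFlower H₁ H₂) F)))) := by
        have hattach : AttachH₁ H₁ F F' → Extends C H₁ F F' ∧ wt y F' < wt y F := by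
          intro h
          obtain ⟨⟨⟨D, hFD, hDc⟩, hcov⟩, hlt⟩ := h.wt_lt hH
          exact ⟨⟨⟨D, hFD, hDc.trans (le_max_left _ _)⟩, hcov⟩, hlt⟩
        have hclose : ∀ e₀ ∈ F.E, CloseE H₁ H₂ F e₀ F' → Extends C H₁ F F' ∧ (F' = F ∨
            wt y F' < wt y F ∨ (wt y F' = wt y F ∧ ∃ L R, Attached H₁ H₂ F' F L R e₀)) := by
          intro e₀ he₀ h
          obtain ⟨⟨⟨D, hFD, hDc⟩, hcov⟩, hcase⟩ := h.trichotomy hH he₀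
          exact ⟨⟨⟨D, hFD, hDc.trans (le_max_right _ _)⟩, hcov⟩, hcase⟩
        rcases hstep.2 with ⟨ho, ha | hc⟩ | ⟨ho, ha | ⟨e, he, hc, -⟩⟩
        · exact ⟨(hattach ha).1, Or.inr (Or.inl (hattach ha).2)⟩
        · obtain ⟨hm, ho'⟩ := helig.mem_open F ho
          obtain ⟨hext, h⟩ := hclose _ hm hc
          exact ⟨hext, h.imp_right (Or.imp_right fun ⟨hw, L, R, hatt⟩ =>
            ⟨hw, _, L, R, hatt, fun _ => ⟨ho', fun hin hfree =>
              helig.avoids_flowers F hfree hin⟩⟩)⟩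
        · exact ⟨(hattach ha).1, Or.inr (Or.inl (hattach ha).2)⟩
        · obtain ⟨hext, h⟩ := hclose e he hc
          exact ⟨hext, h.imp_right (Or.imp_right fun ⟨hw, L, R, hatt⟩ =>
            ⟨hw, _, L, R, hatt, fun h => absurd h ho⟩)⟩
      obtain ⟨⟨D, rfl, hDC⟩, hcov⟩ := hext
      refine ⟨⟨hFne.mono Finset.subset_union_left, hcov hF⟩, ?_⟩
      have hcard : (F ∪ D).V.card ≤ F.V.card + C :=
        (Finset.card_union_le _ _).trans (Nat.add_le_add_left hDC _)
      rcases hcase with h | hlt | ⟨heq, e₀, L, R, hatt, hel⟩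
      · exact Or.inl h
      · exact Or.inr ⟨hcard, Or.inl ⟨hlt, fun n hn => hn.union hDC⟩⟩
      · exact Or.inr ⟨hcard, Or.inr ⟨heq.le, fun n hn => hn.attached hH hatt hF (hcov hF) hel⟩⟩)
  refine ⟨B, fun F hF => hB F hF.1 fun hP => ⟨?_, fun n hn => hn.eq_zero hH hF.2.2⟩⟩
  rw [← hlam]
  exact hF.2.1 F le_rfl hP.1

end

/-! ### The theorem: rational weights and the two cases -/

theorem lam_eq_wt (H₁ H₂ F : KGraph k) : lam H₁ H₂ F = wt (1 / mDens₂ H₁ H₂) F := by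
  rw [lam, wt, one_div_mul_eq_div]

end KGraph

theorem theorem4p2 (k : ℕ) (hk : 2 ≤ k) (H₁ H₂ : KGraph k)
    (hheart : KGraph.IsHeart H₁ H₂) (hdens : 1 < H₂.mDens)
    (ε : ℝ) (hε : 0 ≤ ε)
    (elig eligAlt : KGraph k → Finset ℕ)
    (helig : KGraph.IsEligible (KGraph.OpenEdge H₁ H₂) (KGraph.InFlower H₁ H₂) elig)
    (heligAlt : KGraph.IsEligible (KGraph.OpenEdgeAlt H₁ H₂) (KGraph.InFlowerAlt H₁ H₂) eligAlt) :
    KGraph.FiniteUpToIso (KGraph.BHat H₁ H₂ ε elig eligAlt) := by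
  have hm : 0 < H₂.mDens := by linarith
  have hx : 0 < 1 / H₂.mDens := by positivity
  have hx1 : 1 / H₂.mDens < 1 := by rw [div_lt_one hm]; exact hdens
  have t₂ := hheart.balanced_right.tight hk hdens
  have hint := hheart.balanced_right.exists_int hk hdens
  have h3 := t₂.three_le
  suffices h : ∃ B : ℕ, ∀ F ∈ KGraph.BHat H₁ H₂ ε elig eligAlt, F.V.card ≤ B by
    obtain ⟨B, hB⟩ := h
    exact KGraph.finiteUpToIso_of_card_le hB
  rcases hheart.dens_le.eq_or_lt with heq | hlt
  · have t₁ := (hheart.balanced_left_of_eq heq.symm).tight hk (heq ▸ hdens)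
    rw [← heq] at t₁
    have hN : ((H₂.E.card - 1 : ℕ) : ℝ) * (1 / H₂.mDens)
        = (((H₂.V.card : ℤ) - k : ℤ) : ℝ) := by
      rw [Nat.cast_sub (by omega)]
      push_cast
      exact hint
    obtain ⟨B, hB⟩ := KGraph.exists_card_le_growOutputAlt (ε := ε) hx hx1 t₁ t₂ (by omega) hN
      (fun F => by rw [KGraph.lam_eq_wt, hheart.mDens₂_eq hk hdens heq.symm]) (by omega) heligAlt
    refine ⟨B, fun F hF => ?_⟩
    rcases hF with ⟨h, -⟩ | ⟨-, h⟩
    · exact absurd heq h.ne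
    · exact hB F h
  · obtain ⟨-, hgt⟩ := KGraph.mDens₂_gt hk hheart hdens hlt
    have t₁ := hheart.tightWrt hk hdens hlt
    have hH : KGraph.TightPair (1 / H₂.mDens) (1 / KGraph.mDens₂ H₁ H₂) H₁ H₂ :=
      ⟨one_div_pos.2 (hm.trans hgt), one_div_lt_one_div_of_lt hm hgt, hx1, t₁, t₂⟩
    -- From e(H₁) y = v(H₁) − k + x and (e(H₂) − 1) x = v(H₂) − k the denominator e(H₁)(e(H₂) − 1)
    -- clears y.
    have hN : ((H₁.E.card * (H₂.E.card - 1) : ℕ) : ℝ) * (1 / KGraph.mDens₂ H₁ H₂)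
        = (((H₂.E.card - 1) * (H₁.V.card - k) + (H₂.V.card - k) : ℤ) : ℝ) := by
      have h1 := t₁.wt_eq
      rw [KGraph.wt] at h1
      rw [Nat.cast_mul, Nat.cast_sub (by omega)]
      push_cast
      linear_combination hint - ((H₂.E.card : ℝ) - 1) * h1
    have h3' := t₁.three_le
    obtain ⟨B, hB⟩ := KGraph.exists_card_le_growOutput (ε := ε) hH
      (Nat.mul_pos (by omega) (by omega)) hN (fun F => KGraph.lam_eq_wt H₁ H₂ F) (by omega) helig
    refine ⟨B, fun F hF => ?_⟩
    rcases hF with ⟨-, h⟩ | ⟨h, -⟩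
    · exact hB F h
    · exact absurd h hlt.ne'
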